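/- **Setting.** An LRS Bianchi type VIII model is a metric $-\mathrm dt^2+g_{11}(t)\,\hat\omega^1\otimes\hat\omega^1+g_{22}(t)\,(\hat\omega^2\otimes\hat\omega^2+\hat\omega^3\otimes\hat\omega^3)$, $g_{11},g_{22}>0$, with $\mathrm d\hat\omega^i=-\tfrac12\epsilon_{jkl}\hat n^{ij}\hat\omega^k\wedge\hat\omega^l$, $\hat n=\mathrm{diag}(-1,1,1)$, subject to the Einstein equations without cosmological constant ($8\pi G=c=1$), either in vacuum or with a perfect fluid, non-tilted with respect to $\mathrm dt$, with energy density $\rho>0$ and pressure $p=w\rho$, $w$ constant. Let $k^i{}_j=\mathrm{diag}(k_1,k_2,k_2)$ be the extrinsic curvature, with $\partial_tg_{ij}=-2k_{ij}$, and put $$H=-\tfrac13(k_1+2k_2),\quad \sigma_+=\tfrac13(k_1-k_2),\quad m_1=\frac{\sqrt{g_{11}}}{g_{22}},\quad D=\sqrt{H^2-\frac1{3g_{22}}},\quad (H_D,\Sigma_+,M_1)=\frac{(H,\sigma_+,m_1)}{D}.$$ Solutions are expanding ($H>0$) and defined on a maximal open time interval. For perfect fluids the state $(H_D,\Sigma_+,M_1)$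 lies in $$\mathcal X_{\mathrm{VIII}}=\{H_D>1,\ -1<\Sigma_+<1,\ 0<M_1<\sqrt{12(1-\Sigma_+^2)}\},$$ and for vacuum solutions in the boundary part $M_1=\sqrt{12(1-\Sigma_+^2)}$. Define $r\ge0$, $\theta\in[\frac\pi2,\pi]$ by $1-H_D^2=2r\cos\theta$, $M_1^2=3r\sin\theta$. A solution is *past (future) asymptotic* to a point if its state, in the coordinates $(r,\theta,\Sigma_+)$, converges to that point as $t$ tends to the lower (upper) end of its interval of existence. Consider the points * $T_\flat$ (Taub Kasner): $r=0$, $\theta=\pi$, $\Sigma_+=-1$ (so $H_D=1$, $M_1=0$); * $D$ (type III form of flat spacetime): $H_D=2$, $\Sigma_+=1$, $M_1=0$; * $P$ (Collins type III fluid solution, for $-\frac13<w<0$): $H_D=\frac{2}{1-3w}$, $\Sigma_+=\frac{1+3w}{1-3w}$, $M_1=0$. **Corollary.** 1. Every LRS Bianchi type VIII vacuum solution is past asymptotic to $T_\flat$ and future asymptotic to $D$. 2. For every $w\in(-\frac13,1)$, generic LRS Bianchi type VIII solutions with a non-tilted perfect fluid $p=w\rho$ are past asymptotic to $T_\flat$,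 and future asymptotic to $P$ if $w\in(-\frac13,0)$ and to $D$ if $w\in[0,1)$. Here "generic" means: there is an open set $G\subseteq\mathcal X_{\mathrm{VIII}}$ (depending on $w$) whose complement in $\mathcal X_{\mathrm{VIII}}$ has Lebesgue measure zero, such that the assertion holds for every solution whose state lies in $G$ at some time. -/

import Mathlib

open Filter Topology MeasureTheory Set

/-- The dynamical quantities of a locally rotationally symmetric (LRS) Bianchi class A spacetime
`-dt² + g₁₁(t) ω̂¹⊗ω̂¹ + g₂₂(t) (ω̂²⊗ω̂² + ω̂³⊗ω̂³)` with a perfect fluid that is non-tilted with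
respect to `dt`: the metric components, the mixed components `k₁ = k¹₁`, `k₂ = k²₂ = k³₃` of the
extrinsic curvature (all other components vanish), the energy density and the pressure,
as functions of `t`. -/
structure LRSModel where
  g₁₁ : ℝ → ℝ
  g₂₂ : ℝ → ℝ
  k₁ : ℝ → ℝ
  k₂ : ℝ → ℝ
  ρ : ℝ → ℝ
  p : ℝ → ℝ

/-- The component `R^a_a` of the Ricci tensor of a left-invariant metric on a three-dimensional
unimodular Lie group, with orthonormal coframe `dω^a = -½ ε_{bcd} n^{ab} ω^c ∧ ω^d`,
`n = diag (n_a, n_b, n_c)`. -/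
noncomputable def ricciClassA (na nb nc : ℝ) : ℝ := (na ^ 2 - (nb - nc) ^ 2) / 2

namespace LRSModel

variable (S : LRSModel)

/-- `m₁ = √g₁₁ / g₂₂`. -/
noncomputable def m₁ (t : ℝ) : ℝ := √(S.g₁₁ t) / S.g₂₂ t

/-- Type VIII, `n̂ = diag (-1, 1, 1)`: in the orthonormal coframe `√g_{ii} ω̂ⁱ` the structure
constants are `n_i = n̂_i g_{ii} / √(det g)`, that is, `-√g₁₁/g₂₂` and (twice) `1/√g₁₁`. -/
noncomputable def n₁ (t : ℝ) : ℝ := -S.m₁ t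

/-- See `LRSModel.n₁`. -/
noncomputable def n₂ (t : ℝ) : ℝ := 1 / √(S.g₁₁ t)

/-- The component `R¹₁` of the Ricci tensor of the spatial metric. -/
noncomputable def ric₁ (t : ℝ) : ℝ := ricciClassA (S.n₁ t) (S.n₂ t) (S.n₂ t)

/-- The component `R²₂ = R³₃` of the Ricci tensor of the spatial metric. -/
noncomputable def ric₂ (t : ℝ) : ℝ := ricciClassA (S.n₂ t) (S.n₂ t) (S.n₁ t)

/-- The trace of the extrinsic curvature. -/
noncomputable def trK (t : ℝ) : ℝ := S.k₁ t + 2 * S.k₂ t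

/-- The Einstein equations (without cosmological constant, `8πG = c = 1`) of LRS Bianchi type VIII
for a non-tilted perfect fluid on the open time interval `I`, in 3+1 form:
`∂ₜ g_{ij} = -2 k_{ij}`,
`∂ₜ kⁱⱼ = (tr k) kⁱⱼ + Rⁱⱼ - Tⁱⱼ + ½ δⁱⱼ (Tˡₗ - ρ)` with `Tⁱⱼ = p δⁱⱼ`, and
the Hamiltonian constraint `R + (tr k)² - kⁱⱼ kʲᵢ = 2ρ`.
The momentum constraint holds identically in this symmetry class. -/
structure IsSolution (I : Set ℝ) : Prop where
  isOpen : IsOpen I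
  ordConnected : I.OrdConnected
  nonempty : I.Nonempty
  g₁₁_pos : ∀ t ∈ I, 0 < S.g₁₁ t
  g₂₂_pos : ∀ t ∈ I, 0 < S.g₂₂ t
  deriv_g₁₁ : ∀ t ∈ I, HasDerivAt S.g₁₁ (-2 * (S.g₁₁ t * S.k₁ t)) t
  deriv_g₂₂ : ∀ t ∈ I, HasDerivAt S.g₂₂ (-2 * (S.g₂₂ t * S.k₂ t)) t
  deriv_k₁ : ∀ t ∈ I, HasDerivAt S.k₁
    (S.trK t * S.k₁ t + S.ric₁ t - S.p t + (3 * S.p t - S.ρ t) / 2) t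
  deriv_k₂ : ∀ t ∈ I, HasDerivAt S.k₂
    (S.trK t * S.k₂ t + S.ric₂ t - S.p t + (3 * S.p t - S.ρ t) / 2) t
  hamiltonian : ∀ t ∈ I,
    S.ric₁ t + 2 * S.ric₂ t + S.trK t ^ 2 - (S.k₁ t ^ 2 + 2 * S.k₂ t ^ 2) = 2 * S.ρ t

/-- LRS Bianchi type VIII vacuum solutions. -/
def IsVacuum (S : LRSModel) (I : Set ℝ) : Prop :=
  S.IsSolution I ∧ ∀ t ∈ I, S.ρ t = 0 ∧ S.p t = 0

/-- LRS Bianchi type VIII solutions with a non-tilted perfect fluid with `p = w ρ`, `ρ > 0`. -/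
def IsLinearFluid (w : ℝ) (S : LRSModel) (I : Set ℝ) : Prop :=
  S.IsSolution I ∧ ∀ t ∈ I, 0 < S.ρ t ∧ S.p t = w * S.ρ t

/-- The two models coincide on `I`. -/
def AgreeOn (S S' : LRSModel) (I : Set ℝ) : Prop :=
  ∀ t ∈ I, S.g₁₁ t = S'.g₁₁ t ∧ S.g₂₂ t = S'.g₂₂ t ∧ S.k₁ t = S'.k₁ t ∧ S.k₂ t = S'.k₂ t ∧
    S.ρ t = S'.ρ t ∧ S.p t = S'.p t

/-- `S` is, on the time interval `I`, a maximal (inextendible) solution in the class `C`. -/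
def IsMaximal (C : LRSModel → Set ℝ → Prop) (S : LRSModel) (I : Set ℝ) : Prop :=
  C S I ∧ ∀ (S' : LRSModel) (J : Set ℝ), C S' J → I ⊆ J → S.AgreeOn S' I → J ⊆ I

/-- The Hubble scalar. -/
noncomputable def hubble (t : ℝ) : ℝ := -(S.k₁ t + 2 * S.k₂ t) / 3

/-- The shear variable `σ₊`. -/
noncomputable def shear (t : ℝ) : ℝ := (S.k₁ t - S.k₂ t) / 3

/-- The dominant variable `D`. -/
noncomputable def dominant (t : ℝ) : ℝ := √(S.hubble t ^ 2 - 1 / (3 * S.g₂₂ t))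

/-- The normalised state `(H_D, Σ₊, M₁) = (H, σ₊, m₁) / D`. -/
noncomputable def stateX (t : ℝ) : ℝ × ℝ × ℝ :=
  (S.hubble t / S.dominant t, S.shear t / S.dominant t, S.m₁ t / S.dominant t)

end LRSModel

/-- The (expanding) LRS Bianchi type VIII state space, in the coordinates `(H_D, Σ₊, M₁)`. -/
def XVIII : Set (ℝ × ℝ × ℝ) :=
  {x | 1 < x.1 ∧ x.2.1 ∈ Ioo (-1 : ℝ) 1 ∧ x.2.2 ∈ Ioo (0 : ℝ) (√(12 * (1 - x.2.1 ^ 2)))}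

/-- The radial coordinate `r ≥ 0` with `1 - H_D² = 2 r cos θ`, `M₁² = 3 r sin θ`. -/
noncomputable def coordR (x : ℝ × ℝ × ℝ) : ℝ :=
  √(((1 - x.1 ^ 2) / 2) ^ 2 + (x.2.2 ^ 2 / 3) ^ 2)

/-- The angle `θ ∈ [π/2, π]` with `1 - H_D² = 2 r cos θ`, `M₁² = 3 r sin θ`. -/
noncomputable def coordTheta (x : ℝ × ℝ × ℝ) : ℝ :=
  Real.arccos ((1 - x.1 ^ 2) / (2 * coordR x))

/-- The coordinate transformation `(H_D, Σ₊, M₁) ↦ (r, θ, Σ₊)`. -/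
noncomputable def toY (x : ℝ × ℝ × ℝ) : ℝ × ℝ × ℝ := (coordR x, coordTheta x, x.2.1)

/-- The defining relations of the coordinates `r` and `θ`. -/
theorem toY_spec (x : ℝ × ℝ × ℝ) (hx : 1 < x.1) :
    0 < coordR x ∧ coordTheta x ∈ Icc (Real.pi / 2) Real.pi ∧
      1 - x.1 ^ 2 = 2 * coordR x * Real.cos (coordTheta x) ∧
      x.2.2 ^ 2 = 3 * coordR x * Real.sin (coordTheta x) := by
  have hneg : 1 - x.1 ^ 2 < 0 := by nlinarith
  have hr : 0 < coordR x := by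
    have h1 : 0 < ((1 - x.1 ^ 2) / 2) ^ 2 := by nlinarith
    exact Real.sqrt_pos.2 (by positivity)
  have hsq : coordR x ^ 2 = ((1 - x.1 ^ 2) / 2) ^ 2 + (x.2.2 ^ 2 / 3) ^ 2 :=
    Real.sq_sqrt (by positivity)
  have hb : ((1 - x.1 ^ 2) / (2 * coordR x)) ^ 2 ≤ 1 := by
    rw [div_pow, div_le_one (by positivity)]
    nlinarith [sq_nonneg (x.2.2 ^ 2 / 3)]
  have hb' := abs_le.1 ((sq_le_one_iff_abs_le_one _).1 hb)
  refine ⟨hr, ⟨?_, Real.arccos_le_pi _⟩, ?_, ?_⟩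
  · rw [coordTheta, ← not_lt, Real.arccos_lt_pi_div_two, not_lt]
    exact (div_neg_of_neg_of_pos hneg (by positivity)).le
  · rw [coordTheta, Real.cos_arccos hb'.1 hb'.2]
    field_simp
  · have h : 1 - ((1 - x.1 ^ 2) / (2 * coordR x)) ^ 2 = (x.2.2 ^ 2 / (3 * coordR x)) ^ 2 := by
      field_simp
      linear_combination 36 * hsq
    rw [coordTheta, Real.sin_arccos, h, Real.sqrt_sq (by positivity)]
    field_simp

/-- The Taub Kasner point, in the coordinates `(r, θ, Σ₊)`:
`H_D = 1`, `Σ₊ = -1`, `M₁ = 0`, `θ = π`. -/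
noncomputable def pointTflat : ℝ × ℝ × ℝ := (0, Real.pi, -1)

/-- The type III form of flat spacetime, in the coordinates `(r, θ, Σ₊)`:
`H_D = 2`, `Σ₊ = 1`, `M₁ = 0`. -/
noncomputable def pointD : ℝ × ℝ × ℝ := toY (2, 1, 0)

/-- The Collins type III perfect fluid point, in the coordinates `(r, θ, Σ₊)`:
`H_D = 2 / (1 - 3w)`, `Σ₊ = (1 + 3w) / (1 - 3w)`, `M₁ = 0`. -/
noncomputable def pointP (w : ℝ) : ℝ × ℝ × ℝ :=
  toY (2 / (1 - 3 * w), (1 + 3 * w) / (1 - 3 * w), 0)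

/-!
The variables `v = log (g₁₁ / g₂₂)`, `ζ = log (ρ g₂₂)` and `χ = artanh (σ₊ / H)` are unconstrained:
the Hamiltonian constraint only determines `H`. In the logarithmic time `τ`, `dτ = H dt`, the
Einstein equations become the autonomous system `Reduced.field` on `ℝ³`, which is bounded and globally
Lipschitz, hence has a global flow (`exists_isGlobalFlow`). A parameter `κ` treats fluids (`κ = 1`) and
vacuum (`κ = 0`) together. An orbit of the flow can be turned back into a solution of the Einstein
equations (`LRSModel.isSolution_ofOrbit`); therefore `τ` runs through all of `ℝ` along a maximal
solution (`LRSModel.IsExpanding.exists_extension`), and the claims are about the limits of the reduced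
orbits as `τ → ±∞`.

*Future.* The function `log (1 / (g₂₂ (2 H - σ₊)²))` (in vacuum or for `w ≥ 0`), respectively a
similar function that involves also `ρ` (for `w < 0`), is bounded from above and its derivative
dominates the square of the distance of `σ₊ / H` from its equilibrium value, as well as the curvature
variable `m₁² / H²`. By Barbalat's lemma every orbit converges to the equilibrium
(`Reduced.tendsto_of_monotone`).

*Past.* Where `χ < 0`, it decreases towards the past, and it follows that `χ → -∞` and `v → -∞`,
which is the Taub Kasner point (`Reduced.tendsto_pointTflat`). In vacuum `sinh χ √(1 + 4 e⁻ᵛ)` has a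
derivative that is bounded from below by a positive number, so `χ` becomes negative
(`Reduced.exists_χ_neg_of_vacuum`). With a fluid this holds for almost every initial value: there is a
finite measure with positive density, `Reduced.weight`, which the time-reversed flow expands at a
uniform rate as long as `χ ≥ 0`, so the set of points that remain in this region has measure zero
(`Reduced.volume_forall_nonneg_eq_zero`). The flow is Lipschitz, and its effect on volumes is computed
from that of Euler steps, whose Jacobians are explicit; this avoids the differentiability of the flow
(`IsGlobalFlow.measure_le_measure_image`). Finally `Reduced.toState 1` carries null sets to null sets.
-/

/-! ### Global flows of bounded Lipschitz vector fields -/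

section Flow

variable {E : Type*} [NormedAddCommGroup E] [NormedSpace ℝ E]

/-- `φ t p` is the value at time `t` of a solution of `ẋ = F x`, defined for all times, with initial
value `p`. -/
structure IsGlobalFlow (F : E → E) (φ : ℝ → E → E) : Prop where
  zero : ∀ p, φ 0 p = p
  hasDerivAt : ∀ p t, HasDerivAt (fun s => φ s p) (F (φ t p)) t

theorem exists_isGlobalFlow [CompleteSpace E] {F : E → E} {K B : NNReal} (hF : LipschitzWith K F)
    (hB : ∀ p, ‖F p‖ ≤ B) : ∃ φ, IsGlobalFlow F φ := by
  have loc : ∀ (p : E) (n : ℕ), ∃ α : ℝ → E, α 0 = p ∧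
      ∀ t ∈ Ioo (-(n + 1 : ℝ)) (n + 1), HasDerivAt α (F (α t)) t := by
    intro p n
    have h0 : (0 : ℝ) ∈ Icc (-(n + 1 : ℝ)) (n + 1) := ⟨by linarith [n.cast_nonneg (α := ℝ)],
      by positivity⟩
    have hpl : IsPicardLindelof (fun _ => F) (⟨0, h0⟩ : Icc (-(n + 1 : ℝ)) (n + 1)) p
        (B * (n + 1)) 0 B K := by
      refine IsPicardLindelof.of_time_independent (fun x _ => hB x) hF.lipschitzOnWith ?_
      simp
    obtain ⟨α, hα0, hα⟩ := hpl.exists_eq_forall_mem_Icc_hasDerivWithinAt₀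
    exact ⟨α, hα0, fun t ht => (hα t (Ioo_subset_Icc_self ht)).hasDerivAt (Icc_mem_nhds ht.1 ht.2)⟩
  choose α hα0 hα using loc
  have agree : ∀ p (m n : ℕ), m ≤ n → EqOn (α p m) (α p n) (Ioo (-(m + 1 : ℝ)) (m + 1)) := by
    intro p m n hmn
    have hmn' : (m : ℝ) ≤ n := by exact_mod_cast hmn
    refine ODE_solution_unique_of_mem_Ioo (v := fun _ => F) (s := fun _ => univ) (t₀ := 0) (K := K)
      (fun _ _ => hF.lipschitzOnWith) ⟨by linarith [m.cast_nonneg (α := ℝ)], by positivity⟩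
      (fun t ht => ⟨hα p m t ht, trivial⟩)
      (fun t ht => ⟨hα p n t ⟨by linarith [ht.1], by linarith [ht.2]⟩, trivial⟩) ?_
    rw [hα0, hα0]
  refine ⟨fun t p => α p ⌈|t|⌉₊ t, fun p => hα0 p _, fun p t => ?_⟩
  have hmem : ∀ s : ℝ, s ∈ Ioo (-(⌈|s|⌉₊ + 1 : ℝ)) (⌈|s|⌉₊ + 1) := fun s => by
    have := abs_le.1 (Nat.le_ceil |s|)
    exact ⟨by linarith, by linarith⟩
  -- Near `t`, all the local solutions coincide with the one on the interval chosen for `t`.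
  refine (hα p _ t (hmem t)).congr_of_eventuallyEq ?_
  filter_upwards [Ioo_mem_nhds (hmem t).1 (hmem t).2] with s hs
  rcases le_total ⌈|s|⌉₊ ⌈|t|⌉₊ with h | h
  · exact agree p _ _ h (hmem s)
  · exact (agree p _ _ h hs).symm

namespace IsGlobalFlow

variable {F : E → E} {φ : ℝ → E → E} {K B : NNReal}

theorem eq_of_hasDerivAt (hφ : IsGlobalFlow F φ) (hF : LipschitzWith K F) {γ : ℝ → E} {p : E}
    (h0 : γ 0 = p) (hγ : ∀ t, HasDerivAt γ (F (γ t)) t) (t : ℝ) : γ t = φ t p := by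
  have := ODE_solution_unique_univ (v := fun _ => F) (s := fun _ => univ) (t₀ := 0) (K := K)
    (fun _ => hF.lipschitzOnWith) (fun t => ⟨hγ t, trivial⟩)
    (fun t => ⟨hφ.hasDerivAt p t, trivial⟩) (by rw [h0, hφ.zero])
  exact congrFun this t

theorem add (hφ : IsGlobalFlow F φ) (hF : LipschitzWith K F) (s t : ℝ) (p : E) :
    φ (s + t) p = φ t (φ s p) := by
  refine hφ.eq_of_hasDerivAt hF (γ := fun t => φ (s + t) p) (by simp) (fun t => ?_) t
  simpa [Function.comp_def] using (hφ.hasDerivAt p (s + t)).scomp t ((hasDerivAt_id t).const_add s)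

theorem reverse (hφ : IsGlobalFlow F φ) :
    IsGlobalFlow (fun p => -F p) (fun t p => φ (-t) p) where
  zero p := by simpa using hφ.zero p
  hasDerivAt p t := by
    simpa [Function.comp_def] using (hφ.hasDerivAt p (-t)).scomp t (hasDerivAt_neg t)

theorem continuous_time (hφ : IsGlobalFlow F φ) (p : E) : Continuous fun t => φ t p :=
  continuous_iff_continuousAt.2 fun t => (hφ.hasDerivAt p t).continuousAt

theorem dist_le (hφ : IsGlobalFlow F φ) (hF : LipschitzWith K F) {t : ℝ} (ht : 0 ≤ t) (p q : E) :
    dist (φ t p) (φ t q) ≤ dist p q * Real.exp (K * t) := by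
  have := dist_le_of_trajectories_ODE (v := fun _ => F) (a := 0) (b := t) (K := K) (δ := dist p q)
    (fun _ => hF) (hφ.continuous_time p).continuousOn
    (fun s _ => (hφ.hasDerivAt p s).hasDerivWithinAt) (hφ.continuous_time q).continuousOn
    (fun s _ => (hφ.hasDerivAt q s).hasDerivWithinAt) (by rw [hφ.zero, hφ.zero]) t ⟨ht, le_rfl⟩
  simpa using this

theorem continuous_of_nonneg (hφ : IsGlobalFlow F φ) (hF : LipschitzWith K F) {t : ℝ} (ht : 0 ≤ t) :
    Continuous (φ t) := by
  refine (LipschitzWith.of_dist_le_mul (K := (Real.exp (K * t)).toNNReal) fun p q => ?_).continuous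
  rw [Real.coe_toNNReal _ (Real.exp_pos _).le, mul_comm]
  exact hφ.dist_le hF ht p q

theorem continuous (hφ : IsGlobalFlow F φ) (hF : LipschitzWith K F) (t : ℝ) :
    Continuous (φ t) := by
  rcases le_total 0 t with ht | ht
  · exact hφ.continuous_of_nonneg hF ht
  · have := hφ.reverse.continuous_of_nonneg (K := K) hF.neg (t := -t) (by linarith)
    simpa using this

theorem norm_sub_le (hφ : IsGlobalFlow F φ) (hB : ∀ p, ‖F p‖ ≤ B) {t : ℝ} (ht : 0 ≤ t) (p : E) :
    ‖φ t p - p‖ ≤ B * t := by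
  have := norm_image_sub_le_of_norm_deriv_le_segment' (f := fun t => φ t p) (a := 0) (b := t)
    (fun s _ => (hφ.hasDerivAt p s).hasDerivWithinAt) (fun s _ => hB _) t ⟨ht, le_rfl⟩
  simpa [hφ.zero] using this

/-- The local error of an Euler step. -/
theorem dist_euler_le (hφ : IsGlobalFlow F φ) (hF : LipschitzWith K F) (hB : ∀ p, ‖F p‖ ≤ B)
    {δ : ℝ} (hδ : 0 ≤ δ) (p : E) : dist (φ δ p) (p + δ • F p) ≤ K * B * δ ^ 2 := by
  have hd : ∀ s ∈ Icc 0 δ, HasDerivWithinAt (fun s => φ s p - s • F p) (F (φ s p) - F p)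
      (Icc 0 δ) s := fun s _ => by
    simpa using ((hφ.hasDerivAt p s).fun_sub ((hasDerivAt_id s).smul_const (F p))).hasDerivWithinAt
  have hb : ∀ s ∈ Ico 0 δ, ‖F (φ s p) - F p‖ ≤ K * (B * δ) := fun s hs => by
    refine (hF.norm_sub_le _ _).trans ?_
    gcongr
    exact (hφ.norm_sub_le hB hs.1 p).trans (by gcongr; exact hs.2.le)
  have := norm_image_sub_le_of_norm_deriv_le_segment' hd hb δ ⟨hδ, le_rfl⟩
  simp only [hφ.zero, zero_smul, sub_zero] at this
  rw [dist_eq_norm, ← sub_sub, sub_right_comm]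
  exact this.trans (by nlinarith)

/-- The global error of the Euler method. -/
theorem dist_euler_iterate_le (hφ : IsGlobalFlow F φ) (hF : LipschitzWith K F)
    (hB : ∀ p, ‖F p‖ ≤ B) {δ : ℝ} (hδ : 0 ≤ δ) (p : E) (n : ℕ) :
    dist (φ (n * δ) p) ((fun q => q + δ • F q)^[n] p) ≤
      n * (K * B * δ ^ 2) * (1 + K * δ) ^ n := by
  induction n with
  | zero => simp [hφ.zero]
  | succ n ih =>
    set ψ : E → E := fun q => q + δ • F q with hψ
    set q := φ (n * δ) p
    set q' := ψ^[n] p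
    have e1 : φ ((n + 1 : ℕ) * δ) p = φ δ q := by
      rw [← hφ.add hF]; push_cast; ring_nf
    have hlip : dist (ψ q) (ψ q') ≤ (1 + K * δ) * dist q q' := by
      have : ψ q - ψ q' = (q - q') + δ • (F q - F q') := by simp only [hψ]; module
      rw [dist_eq_norm, this, dist_eq_norm]
      refine (norm_add_le _ _).trans ?_
      rw [norm_smul, Real.norm_of_nonneg hδ]
      have := mul_le_mul_of_nonneg_left (hF.norm_sub_le q q') hδ
      linarith
    rw [e1, Function.iterate_succ_apply']
    have h1 : 1 ≤ 1 + K * δ := by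
      have := mul_nonneg K.coe_nonneg hδ
      linarith
    have h2 : 1 ≤ (1 + K * δ) ^ (n + 1) := one_le_pow₀ h1
    calc dist (φ δ q) (ψ q') ≤ dist (φ δ q) (ψ q) + dist (ψ q) (ψ q') := dist_triangle _ _ _
      _ ≤ K * B * δ ^ 2 + (1 + K * δ) * (n * (K * B * δ ^ 2) * (1 + K * δ) ^ n) := by
          gcongr
          · exact hφ.dist_euler_le hF hB hδ q
          · exact hlip.trans (by gcongr)
      _ = K * B * δ ^ 2 * 1 + n * (K * B * δ ^ 2) * (1 + K * δ) ^ (n + 1) := by ring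
      _ ≤ K * B * δ ^ 2 * (1 + K * δ) ^ (n + 1)
          + n * (K * B * δ ^ 2) * (1 + K * δ) ^ (n + 1) := by gcongr
      _ = _ := by push_cast; ring

end IsGlobalFlow

end Flow

/-! ### Sets that a volume expanding flow does not leave -/

section Expansion

variable {E : Type*} [NormedAddCommGroup E] [NormedSpace ℝ E] [ProperSpace E] [MeasurableSpace E]
  [BorelSpace E] {F : E → E} {φ : ℝ → E → E} {K B : NNReal} {μ : Measure E} [IsFiniteMeasure μ]
  {S : Set E} {c η δ₀ : ℝ}

/-- If Euler steps expand the measure of subsets of a neighbourhood of `S`, then the flow expands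
the measure of compact sets of points that do not leave `S`: the image under the flow is the limit of
the images under the Euler method, and the measure is upper semicontinuous along this limit. -/
theorem IsGlobalFlow.measure_le_measure_image (hφ : IsGlobalFlow F φ) (hF : LipschitzWith K F)
    (hB : ∀ p, ‖F p‖ ≤ B) (hc : 0 < c) (hη : 0 < η) (hδ₀ : 0 < δ₀)
    (hexp : ∀ δ, 0 < δ → δ < δ₀ → ∀ A, MeasurableSet A → A ⊆ Metric.thickening η S →
      (1 + c * δ) * μ.real A ≤ μ.real ((fun p => p + δ • F p) '' A))
    {A : Set E} (hA : IsCompact A) (hAS : ∀ p ∈ A, ∀ t, 0 ≤ t → φ t p ∈ S) :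
    (1 + c) * μ.real A ≤ μ.real (φ 1 '' A) := by
  set C : ℝ := K * B * Real.exp K with hC
  have hC0 : 0 ≤ C := by positivity
  -- The error of `j` steps of length `1 / n`, `j ≤ n`.
  have herr : ∀ n : ℕ, 0 < n → ∀ j ≤ n, ∀ p,
      dist (φ (j * (1 / n : ℝ)) p) ((fun q => q + (1 / n : ℝ) • F q)^[j] p) ≤ C / n := by
    intro n hn j hj p
    have hn' : (0 : ℝ) < n := by exact_mod_cast hn
    have hj' : (j : ℝ) ≤ n := by exact_mod_cast hj
    have h1 : (1 + (K : ℝ) * (1 / n)) ^ j ≤ Real.exp K := by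
      calc (1 + (K : ℝ) * (1 / n)) ^ j ≤ (Real.exp (K * (1 / n))) ^ j := by
            gcongr; rw [add_comm]; exact Real.add_one_le_exp _
        _ = Real.exp (j * (K * (1 / n))) := by rw [← Real.exp_nat_mul]
        _ ≤ Real.exp K := by
            gcongr
            calc (j : ℝ) * (K * (1 / n)) ≤ n * (K * (1 / n)) := by gcongr
              _ = K := by field_simp
    calc _ ≤ j * (K * B * (1 / n : ℝ) ^ 2) * (1 + K * (1 / n : ℝ)) ^ j :=
          hφ.dist_euler_iterate_le hF hB (by positivity) p j
      _ ≤ n * (K * B * (1 / n : ℝ) ^ 2) * Real.exp K := by gcongr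
      _ = C / n := by rw [hC]; field_simp
  have hcont : ∀ n : ℕ, Continuous (fun q => q + (1 / n : ℝ) • F q) := fun n => by
    have := hF.continuous
    fun_prop
  have hlim : Tendsto (fun n : ℕ => C / n) atTop (𝓝 0) := tendsto_const_div_atTop_nhds_zero_nat C
  have key : ∀ᶠ n : ℕ in atTop,
      (1 + c) * μ.real A ≤ μ.real (Metric.cthickening (C / n) (φ 1 '' A)) := by
    have hev : ∀ᶠ n : ℕ in atTop, (1 / n : ℝ) < δ₀ :=
      (tendsto_const_div_atTop_nhds_zero_nat 1).eventually_lt_const hδ₀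
    filter_upwards [hlim.eventually_lt_const hη, hev, eventually_gt_atTop 0] with n hn1 hn2 hn
    have hn' : (0 : ℝ) < n := by exact_mod_cast hn
    set ψ : E → E := fun q => q + (1 / n : ℝ) • F q with hψ
    have hstep : ∀ j ≤ n, (1 + c * (1 / n : ℝ)) ^ j * μ.real A ≤ μ.real (ψ^[j] '' A) := by
      intro j
      induction j with
      | zero => simp
      | succ j ih =>
        intro hj
        have h1 := hexp (1 / n) (by positivity) hn2 (ψ^[j] '' A)
          (hA.image ((hcont n).iterate j)).isClosed.measurableSet (by
            rintro _ ⟨p, hp, rfl⟩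
            rw [Metric.mem_thickening_iff]
            exact ⟨φ (j * (1 / n : ℝ)) p, hAS p hp _ (by positivity), by
              rw [dist_comm]; exact (herr n hn j (by omega) p).trans_lt hn1⟩)
        rw [← image_comp, ← hψ, ← Function.iterate_succ'] at h1
        refine le_trans ?_ h1
        rw [pow_succ', mul_assoc]
        gcongr
        exact ih (by omega)
    have hbern : 1 + c ≤ (1 + c * (1 / n : ℝ)) ^ n := by
      have := one_add_mul_le_pow (a := c * (1 / n : ℝ)) (by
        have : 0 < c * (1 / n : ℝ) := by positivity
        linarith) n
      calc 1 + c = 1 + n * (c * (1 / n : ℝ)) := by field_simp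
        _ ≤ _ := this
    calc (1 + c) * μ.real A ≤ (1 + c * (1 / n : ℝ)) ^ n * μ.real A := by gcongr
      _ ≤ μ.real (ψ^[n] '' A) := hstep n le_rfl
      _ ≤ _ := by
        refine measureReal_mono ?_
        rintro _ ⟨p, hp, rfl⟩
        refine Metric.mem_cthickening_of_dist_le _ (φ 1 p) _ _ (mem_image_of_mem _ hp) ?_
        have := herr n hn n le_rfl p
        rw [mul_one_div_cancel hn'.ne'] at this
        rwa [dist_comm]
  have hcpt : IsCompact (φ 1 '' A) := hA.image (hφ.continuous hF 1)
  have hm : Tendsto (fun n : ℕ => μ.real (Metric.cthickening (C / n) (φ 1 '' A))) atTop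
      (𝓝 (μ.real (φ 1 '' A))) :=
    (ENNReal.tendsto_toReal (measure_ne_top _ _)).comp
      ((tendsto_measure_cthickening_of_isCompact hcpt).comp hlim)
  exact ge_of_tendsto hm key

/-- A flow that expands a finite measure leaves `S` from almost every initial point. -/
theorem IsGlobalFlow.measure_forall_mem_eq_zero (hφ : IsGlobalFlow F φ) (hF : LipschitzWith K F)
    (hB : ∀ p, ‖F p‖ ≤ B) (hc : 0 < c) (hη : 0 < η) (hδ₀ : 0 < δ₀)
    (hexp : ∀ δ, 0 < δ → δ < δ₀ → ∀ A, MeasurableSet A → A ⊆ Metric.thickening η S →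
      (1 + c * δ) * μ.real A ≤ μ.real ((fun p => p + δ • F p) '' A)) (hS : IsClosed S) :
    μ {p | ∀ t, 0 ≤ t → φ t p ∈ S} = 0 := by
  set N : Set E := {p | ∀ t, 0 ≤ t → φ t p ∈ S} with hN
  have hNc : IsClosed N := by
    have : N = ⋂ t : ℝ, ⋂ _ : 0 ≤ t, φ t ⁻¹' S := by ext p; simp [hN]
    rw [this]
    exact isClosed_iInter fun t => isClosed_iInter fun _ => hS.preimage (hφ.continuous hF t)
  have hzero : ∀ A ⊆ N, IsCompact A → μ.real A = 0 := by
    intro A hAN hA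
    have hiter : ∀ k : ℕ, ∃ A' ⊆ N, IsCompact A' ∧ (1 + c) ^ k * μ.real A ≤ μ.real A' := by
      intro k
      induction k with
      | zero => exact ⟨A, hAN, hA, by simp⟩
      | succ k ih =>
        obtain ⟨A', h1, h2, h3⟩ := ih
        refine ⟨φ 1 '' A', ?_, h2.image (hφ.continuous hF 1), ?_⟩
        · rintro _ ⟨p, hp, rfl⟩ t ht
          rw [← hφ.add hF]
          exact h1 hp _ (by positivity)
        · refine le_trans ?_ (hφ.measure_le_measure_image hF hB hc hη hδ₀ hexp h2 fun p hp => h1 hp)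
          rw [pow_succ', mul_assoc]
          gcongr
    by_contra hne
    have hpos : 0 < μ.real A := lt_of_le_of_ne measureReal_nonneg (Ne.symm hne)
    obtain ⟨k, hk⟩ := pow_unbounded_of_one_lt (μ.real univ / μ.real A) (by linarith : 1 < 1 + c)
    obtain ⟨A', -, -, h3⟩ := hiter k
    rw [div_lt_iff₀ hpos] at hk
    linarith [measureReal_mono (μ := μ) (subset_univ A')]
  have hcov : N = ⋃ n : ℕ, N ∩ Metric.closedBall 0 n := by
    rw [← inter_iUnion, Metric.iUnion_closedBall_nat, inter_univ]
  rw [hcov]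
  refine measure_iUnion_null fun n => ?_
  have := hzero _ inter_subset_left ((isCompact_closedBall (0 : E) n).inter_left hNc)
  rwa [measureReal_eq_zero_iff] at this

end Expansion

/-! ### The reduced vector field -/

theorem Real.hasDerivAt_tanh (y : ℝ) : HasDerivAt Real.tanh (1 - Real.tanh y ^ 2) y := by
  have h := (Real.hasDerivAt_sinh y).fun_div (Real.hasDerivAt_cosh y) (Real.cosh_pos y).ne'
  have h2 : Real.tanh = fun x => Real.sinh x / Real.cosh x := funext Real.tanh_eq_sinh_div_cosh
  rw [h2]
  convert! h using 1
  have := (Real.cosh_pos y).ne'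
  field_simp

namespace Reduced

variable (κ s : ℝ) (p : ℝ × ℝ × ℝ)

/-- In units of `1 / g₂₂`, the sum of the potentials `m₁² / 4`, `1 / g₂₂` and `ρ`, as a function of
`(v, ζ, χ)`, where `e ^ v = g₁₁ / g₂₂` and `κ e ^ ζ = ρ g₂₂`. The number `κ` is `1` for perfect fluids
and `0` in vacuum. -/
noncomputable def potential : ℝ := Real.exp p.1 / 4 + 1 + κ * Real.exp p.2.1

/-- The fraction of `m₁² / 4` in the potential. -/
noncomputable def wM : ℝ := Real.exp p.1 / 4 / potential κ p

/-- The fraction of `1 / g₂₂` in the potential. -/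
noncomputable def wB : ℝ := 1 / potential κ p

/-- The fraction of the energy density in the potential. -/
noncomputable def wF : ℝ := κ * Real.exp p.2.1 / potential κ p

/-- The derivative of `χ` with respect to the logarithmic time. -/
noncomputable def accel : ℝ :=
  -(2 - s / 2 * wF κ p) * Real.tanh p.2.2 + 4 * wM κ p + wB κ p

/-- The Einstein equations of LRS Bianchi type VIII in the unconstrained variables
`v = log (g₁₁ / g₂₂)`, `ζ = log (ρ g₂₂)`, `χ = artanh (σ₊ / H)` and the time `τ` with `dτ = H dt`.
Here `s = 1 + 3 w`. -/
noncomputable def field : ℝ × ℝ × ℝ :=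
  (-6 * Real.tanh p.2.2, 2 * Real.tanh p.2.2 - s, accel κ s p)

variable {κ s : ℝ} (hκ : 0 ≤ κ)

include hκ in
theorem potential_pos : 0 < potential κ p := by
  unfold potential
  positivity

include hκ in
theorem wM_pos : 0 < wM κ p := div_pos (by positivity) (potential_pos p hκ)

include hκ in
theorem wB_pos : 0 < wB κ p := div_pos one_pos (potential_pos p hκ)

include hκ in
theorem wF_nonneg : 0 ≤ wF κ p := div_nonneg (by positivity) (potential_pos p hκ).le

include hκ in
theorem w_sum : wM κ p + wB κ p + wF κ p = 1 := by
  have := (potential_pos p hκ).ne'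
  unfold wM wB wF
  rw [← add_div, ← add_div, div_eq_one_iff_eq this]
  rfl

include hκ in
theorem wF_lt_one : wF κ p < 1 := by
  linarith [w_sum p hκ, wM_pos p hκ, wB_pos p hκ]

include hκ in
theorem wM_le_one : wM κ p ≤ 1 := by
  linarith [w_sum p hκ, wF_nonneg p hκ, wB_pos p hκ]

include hκ in
theorem wB_le_one : wB κ p ≤ 1 := by
  linarith [w_sum p hκ, wF_nonneg p hκ, wM_pos p hκ]

theorem wM_eq : wM κ p = Real.exp p.1 / 4 * wB κ p := by
  rw [wM, wB]; ring

theorem wF_eq : wF κ p = κ * Real.exp p.2.1 * wB κ p := by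
  rw [wF, wB]; ring

variable (hs0 : 0 < s) (hs4 : s < 4)

include hκ hs0 hs4 in
theorem abs_accel_le : |accel κ s p| ≤ 6 := by
  have h1 := wM_pos p hκ
  have h2 := wB_pos p hκ
  have h3 := wF_nonneg p hκ
  have h4 := w_sum p hκ
  have h5 := abs_lt.1 (Real.abs_tanh_lt_one p.2.2)
  have h6 : 0 ≤ 2 - s / 2 * wF κ p := by nlinarith [wF_lt_one p hκ]
  have h7 : 2 - s / 2 * wF κ p ≤ 2 := by nlinarith
  unfold accel
  rw [abs_le]
  constructor <;> nlinarith [h5.1, h5.2]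

include hκ hs0 hs4 in
theorem norm_field_le : ‖field κ s p‖ ≤ (6 : NNReal) := by
  have h5 := abs_lt.1 (Real.abs_tanh_lt_one p.2.2)
  simp only [field, Prod.norm_def, Real.norm_eq_abs, NNReal.coe_ofNat, sup_le_iff]
  refine ⟨?_, ?_, abs_accel_le p hκ hs0 hs4⟩ <;> rw [abs_le] <;> constructor <;> linarith [h5.1, h5.2]

/-! ### Derivatives of the reduced vector field -/

/-- The coordinate `v` as a linear form. -/
noncomputable def dv : ℝ × ℝ × ℝ →L[ℝ] ℝ := ContinuousLinearMap.fst ℝ ℝ (ℝ × ℝ)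

/-- The coordinate `ζ` as a linear form. -/
noncomputable def dζ : ℝ × ℝ × ℝ →L[ℝ] ℝ :=
  (ContinuousLinearMap.fst ℝ ℝ ℝ).comp (ContinuousLinearMap.snd ℝ ℝ (ℝ × ℝ))

/-- The coordinate `χ` as a linear form. -/
noncomputable def dχ : ℝ × ℝ × ℝ →L[ℝ] ℝ :=
  (ContinuousLinearMap.snd ℝ ℝ ℝ).comp (ContinuousLinearMap.snd ℝ ℝ (ℝ × ℝ))

@[simp] theorem dv_apply (q : ℝ × ℝ × ℝ) : dv q = q.1 := rfl
@[simp] theorem dζ_apply (q : ℝ × ℝ × ℝ) : dζ q = q.2.1 := rfl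
@[simp] theorem dχ_apply (q : ℝ × ℝ × ℝ) : dχ q = q.2.2 := rfl

/-- `∂ accel / ∂ v`. -/
noncomputable def accelV (κ s : ℝ) (p : ℝ × ℝ × ℝ) : ℝ :=
  s / 2 * Real.tanh p.2.2 * (-(wF κ p * wM κ p)) + 4 * (wM κ p * (1 - wM κ p)) - wB κ p * wM κ p

/-- `∂ accel / ∂ ζ`. -/
noncomputable def accelZ (κ s : ℝ) (p : ℝ × ℝ × ℝ) : ℝ :=
  s / 2 * Real.tanh p.2.2 * (wF κ p * (1 - wF κ p)) - 4 * (wM κ p * wF κ p) - wB κ p * wF κ p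

/-- `∂ accel / ∂ χ`. -/
noncomputable def accelX (κ s : ℝ) (p : ℝ × ℝ × ℝ) : ℝ :=
  -(2 - s / 2 * wF κ p) * (1 - Real.tanh p.2.2 ^ 2)

/-- The derivative of `Reduced.field`. -/
noncomputable def fieldDeriv (κ s : ℝ) (p : ℝ × ℝ × ℝ) : ℝ × ℝ × ℝ →L[ℝ] ℝ × ℝ × ℝ :=
  ((-6 * (1 - Real.tanh p.2.2 ^ 2)) • dχ).prod (((2 * (1 - Real.tanh p.2.2 ^ 2)) • dχ).prod
    (accelV κ s p • dv + accelZ κ s p • dζ + accelX κ s p • dχ))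

theorem hasFDerivAt_tanh : HasFDerivAt (fun q : ℝ × ℝ × ℝ => Real.tanh q.2.2)
    ((1 - Real.tanh p.2.2 ^ 2) • dχ) p :=
  HasDerivAt.comp_hasFDerivAt (f := fun q : ℝ × ℝ × ℝ => q.2.2) p (Real.hasDerivAt_tanh p.2.2)
    dχ.hasFDerivAt

include hκ in
theorem hasFDerivAt_potential : HasFDerivAt (potential κ)
    (potential κ p • (wM κ p • dv + wF κ p • dζ)) p := by
  have h1 := (dv.hasFDerivAt (x := p)).exp
  have h2 := (dζ.hasFDerivAt (x := p)).exp
  have h := ((h1.mul_const (1 / 4)).add_const 1).fun_add (h2.const_mul κ)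
  have hZ := (potential_pos p hκ).ne'
  convert! h using 1
  · ext q; simp [potential]; ring
  · refine ContinuousLinearMap.ext fun q => ?_
    simp [wM, wF]
    field_simp

include hκ in
theorem hasFDerivAt_wB : HasFDerivAt (wB κ)
    (wB κ p • (-(wM κ p • dv + wF κ p • dζ))) p := by
  have hZ := (potential_pos p hκ).ne'
  have h := (hasDerivAt_inv hZ).comp_hasFDerivAt p (hasFDerivAt_potential p hκ)
  convert! h using 1
  · ext q; simp [wB]
  · refine ContinuousLinearMap.ext fun q => ?_
    simp [wB]
    field_simp
    ring

include hκ in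
theorem hasFDerivAt_wM : HasFDerivAt (wM κ)
    (wM κ p • (dv - (wM κ p • dv + wF κ p • dζ))) p := by
  have h := ((dv.hasFDerivAt (x := p)).exp.mul_const (1 / 4)).fun_mul (hasFDerivAt_wB p hκ)
  convert! h using 1
  · ext q; rw [wM_eq, dv_apply]; ring
  · refine ContinuousLinearMap.ext fun q => ?_
    have := wM_eq (κ := κ) p
    simp [-mul_eq_mul_left_iff]
    linear_combination (q.1 - (wM κ p * q.1 + wF κ p * q.2.1)) * this

include hκ in
theorem hasFDerivAt_wF : HasFDerivAt (wF κ)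
    (wF κ p • (dζ - (wM κ p • dv + wF κ p • dζ))) p := by
  have h := ((dζ.hasFDerivAt (x := p)).exp.const_mul κ).fun_mul (hasFDerivAt_wB p hκ)
  convert! h using 1
  · ext q; simp [wF_eq]
  · refine ContinuousLinearMap.ext fun q => ?_
    have := wF_eq (κ := κ) p
    simp [-mul_eq_mul_left_iff]
    linear_combination (q.2.1 - (wM κ p * q.1 + wF κ p * q.2.1)) * this

include hκ in
theorem hasFDerivAt_accel : HasFDerivAt (accel κ s)
    (accelV κ s p • dv + accelZ κ s p • dζ + accelX κ s p • dχ) p := by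
  have h := (((((hasFDerivAt_wF p hκ).const_mul (s / 2)).const_sub 2).fun_neg.fun_mul
    (hasFDerivAt_tanh p)).fun_add ((hasFDerivAt_wM p hκ).const_mul 4)).fun_add (hasFDerivAt_wB p hκ)
  convert! h using 1
  refine ContinuousLinearMap.ext fun q => ?_
  simp [accelV, accelZ, accelX]
  ring

include hκ in
theorem hasFDerivAt_field : HasFDerivAt (field κ s) (fieldDeriv κ s p) p := by
  refine HasFDerivAt.prodMk ?_ (HasFDerivAt.prodMk ?_ (hasFDerivAt_accel p hκ))
  · have := (hasFDerivAt_tanh p).const_mul (-6)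
    rwa [smul_smul] at this
  · have := ((hasFDerivAt_tanh p).const_mul 2).sub_const s
    rwa [smul_smul] at this

include hκ hs0 hs4 in
theorem abs_accelV_le : |accelV κ s p| ≤ 10 := by
  have h1 := wM_pos p hκ
  have h2 := wB_pos p hκ
  have h3 := wF_nonneg p hκ
  have h4 := w_sum p hκ
  have h5 := Real.abs_tanh_lt_one p.2.2
  have b1 : |s / 2 * Real.tanh p.2.2 * (-(wF κ p * wM κ p))| ≤ 2 := by
    rw [abs_mul, abs_mul, abs_neg, abs_mul, abs_of_nonneg h3, abs_of_pos h1,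
      abs_of_pos (by positivity : 0 < s / 2)]
    have : wF κ p * wM κ p ≤ 1 := by nlinarith
    have h6 : s / 2 * |Real.tanh p.2.2| ≤ 2 := by nlinarith [abs_nonneg (Real.tanh p.2.2)]
    calc _ ≤ 2 * (1 : ℝ) := by gcongr
      _ = 2 := by norm_num
  unfold accelV
  have := abs_le.1 b1
  rw [abs_le]
  constructor <;> nlinarith [this.1, this.2, mul_pos h1 h2, mul_pos h1 h1]

include hκ hs0 hs4 in
theorem abs_accelZ_le : |accelZ κ s p| ≤ 10 := by
  have h1 := wM_pos p hκ
  have h2 := wB_pos p hκ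
  have h3 := wF_nonneg p hκ
  have h4 := w_sum p hκ
  have h5 := Real.abs_tanh_lt_one p.2.2
  have b1 : |s / 2 * Real.tanh p.2.2 * (wF κ p * (1 - wF κ p))| ≤ 2 := by
    have h7 : 0 ≤ 1 - wF κ p := by linarith
    rw [abs_mul, abs_mul, abs_mul, abs_of_nonneg h3, abs_of_nonneg h7,
      abs_of_pos (by positivity : 0 < s / 2)]
    have : wF κ p * (1 - wF κ p) ≤ 1 := by nlinarith
    have h6 : s / 2 * |Real.tanh p.2.2| ≤ 2 := by nlinarith [abs_nonneg (Real.tanh p.2.2)]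
    calc _ ≤ 2 * (1 : ℝ) := by gcongr
      _ = 2 := by norm_num
  unfold accelZ
  have := abs_le.1 b1
  rw [abs_le]
  constructor <;> nlinarith [this.1, this.2, mul_nonneg h1.le h3, mul_nonneg h2.le h3]

include hκ hs0 hs4 in
theorem accelX_mem : -2 ≤ accelX κ s p ∧ accelX κ s p ≤ 0 := by
  have h3 := wF_nonneg p hκ
  have h4 := wF_lt_one p hκ
  have h5 := Real.tanh_sq_lt_one p.2.2
  have h6 : 0 ≤ 2 - s / 2 * wF κ p := by nlinarith
  have h7 : 2 - s / 2 * wF κ p ≤ 2 := by nlinarith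
  unfold accelX
  constructor <;> nlinarith [sq_nonneg (Real.tanh p.2.2)]

include hκ hs0 hs4 in
theorem lipschitzWith_field : LipschitzWith 22 (field κ s) := by
  refine lipschitzWith_of_nnnorm_fderiv_le
    (fun p => (hasFDerivAt_field p hκ).differentiableAt) fun p => ?_
  rw [(hasFDerivAt_field p hκ).fderiv, ← NNReal.coe_le_coe, coe_nnnorm]
  refine ContinuousLinearMap.opNorm_le_bound _ (by norm_num) fun q => ?_
  have q1 : |q.1| ≤ ‖q‖ := norm_fst_le q
  have q2 : |q.2.1| ≤ ‖q‖ := (norm_fst_le q.2).trans (norm_snd_le q)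
  have q3 : |q.2.2| ≤ ‖q‖ := (norm_snd_le q.2).trans (norm_snd_le q)
  have hn := norm_nonneg q
  have ht : 0 ≤ 1 - Real.tanh p.2.2 ^ 2 := by linarith [Real.tanh_sq_lt_one p.2.2]
  have ht1 : 1 - Real.tanh p.2.2 ^ 2 ≤ 1 := by nlinarith
  have key : ∀ a y b c : ℝ, |a| ≤ b → |y| ≤ c → |a * y| ≤ b * c := fun a y b c h1 h2 => by
    rw [abs_mul]
    exact mul_le_mul h1 h2 (abs_nonneg _) ((abs_nonneg _).trans h1)
  have hx : |accelX κ s p| ≤ 2 := abs_le.2 ⟨(accelX_mem p hκ hs0 hs4).1, by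
    linarith [(accelX_mem p hκ hs0 hs4).2]⟩
  generalize ‖q‖ = N at *
  simp only [fieldDeriv, ContinuousLinearMap.prod_apply, Prod.norm_def, Real.norm_eq_abs,
    add_apply, smul_apply, smul_eq_mul, dv_apply, dζ_apply,
    dχ_apply, NNReal.coe_ofNat, sup_le_iff]
  refine ⟨?_, ?_, ?_⟩
  · have := key (-6 * (1 - Real.tanh p.2.2 ^ 2)) _ 6 _ (by rw [abs_le]; constructor <;> linarith) q3
    linarith
  · have := key (2 * (1 - Real.tanh p.2.2 ^ 2)) _ 2 _ (by rw [abs_le]; constructor <;> linarith) q3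
    linarith
  · have e1 := key _ _ _ _ (abs_accelV_le p hκ hs0 hs4) q1
    have e2 := key _ _ _ _ (abs_accelZ_le p hκ hs0 hs4) q2
    have e3 := key _ _ _ _ hx q3
    refine (abs_add_three _ _ _).trans ?_
    linarith

include hκ hs0 hs4 in
theorem exists_flow : ∃ φ, IsGlobalFlow (field κ s) φ :=
  exists_isGlobalFlow (lipschitzWith_field hκ hs0 hs4) fun p => norm_field_le p hκ hs0 hs4

end Reduced

/-! ### Almost every orbit reaches negative shear in the past -/

/-- If the density of a measure grows along a map at least as fast as its Jacobian allows, then the map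
expands the measure. -/
theorem withDensity_mul_real_le_real_image {E : Type*} [NormedAddCommGroup E] [NormedSpace ℝ E]
    [FiniteDimensional ℝ E] [MeasurableSpace E] [BorelSpace E] {ν : Measure E} [ν.IsAddHaarMeasure]
    {W : E → ℝ} {ψ : E → E} {ψ' : E → E →L[ℝ] E} {A : Set E} {k : ℝ} (hk : 0 ≤ k)
    [IsFiniteMeasure (ν.withDensity fun p => ENNReal.ofReal (W p))]
    (hA : MeasurableSet A) (hψ : ∀ p ∈ A, HasFDerivWithinAt ψ (ψ' p) A p) (hinj : InjOn ψ A)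
    (hW : ∀ p ∈ A, k * W p ≤ |(ψ' p).det| * W (ψ p)) :
    k * (ν.withDensity fun p => ENNReal.ofReal (W p)).real A ≤
      (ν.withDensity fun p => ENNReal.ofReal (W p)).real (ψ '' A) := by
  have hm : MeasurableSet (ψ '' A) := measurable_image_of_fderivWithin hA hψ hinj
  have h : ENNReal.ofReal k * (ν.withDensity fun p => ENNReal.ofReal (W p)) A ≤
      (ν.withDensity fun p => ENNReal.ofReal (W p)) (ψ '' A) := by
    rw [withDensity_apply _ hA, withDensity_apply _ hm,
      lintegral_image_eq_lintegral_abs_det_fderiv_mul ν hA hψ hinj,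
      ← lintegral_const_mul' _ _ ENNReal.ofReal_ne_top]
    refine setLIntegral_mono' hA fun p hp => ?_
    rw [← ENNReal.ofReal_mul hk, ← ENNReal.ofReal_mul (abs_nonneg _)]
    exact ENNReal.ofReal_le_ofReal (hW p hp)
  have h2 := ENNReal.toReal_mono (measure_ne_top _ _) h
  rwa [ENNReal.toReal_mul, ENNReal.toReal_ofReal hk] at h2

namespace Reduced

/-- The determinant of a linear map that is the identity up to its last row and column. -/
theorem det_eq (a b c d e : ℝ) :
    ((dv + a • dχ).prod ((dζ + b • dχ).prod (c • dv + d • dζ + e • dχ)) :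
      ℝ × ℝ × ℝ →L[ℝ] ℝ × ℝ × ℝ).det = e - a * c - b * d := by
  set L : ℝ × ℝ × ℝ →L[ℝ] ℝ × ℝ × ℝ :=
    (dv + a • dχ).prod ((dζ + b • dχ).prod (c • dv + d • dζ + e • dχ))
  obtain ⟨eqv, h1, h2⟩ : ∃ eqv : (ℝ × ℝ × ℝ) ≃ₗ[ℝ] (Fin 3 → ℝ),
      (∀ q, eqv q = ![q.1, q.2.1, q.2.2]) ∧ ∀ f, eqv.symm f = (f 0, f 1, f 2) :=
    ⟨{toFun := fun q => ![q.1, q.2.1, q.2.2]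
      invFun := fun f => (f 0, f 1, f 2)
      map_add' := fun x y => by ext i; fin_cases i <;> simp
      map_smul' := fun r x => by ext i; fin_cases i <;> simp
      left_inv := fun q => rfl
      right_inv := fun f => by ext i; fin_cases i <;> rfl}, fun _ => rfl, fun _ => rfl⟩
  have hM : eqv.toLinearMap ∘ₗ (L : ℝ × ℝ × ℝ →ₗ[ℝ] ℝ × ℝ × ℝ) ∘ₗ eqv.symm.toLinearMap =
      Matrix.toLin' !![1, 0, a; 0, 1, b; c, d, e] := by
    refine LinearMap.ext fun f => ?_
    ext i
    fin_cases i <;>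
      simp [h1, h2, L, Matrix.toLin'_apply, Matrix.mulVec, dotProduct, Fin.sum_univ_three]
  rw [ContinuousLinearMap.det, ← LinearMap.det_conj _ eqv, hM, LinearMap.det_toLin',
    Matrix.det_fin_three]
  simp
  ring

/-- The density of the finite measure that the flow contracts where `χ ≥ 0`: up to a constant
factor the number `(a² β Ω) ^ ε`, where `a`, `β`, `Ω` are the contributions of `m₁²`, `1 / g₂₂` and `ρ` to the
Hamiltonian constraint, normalised by `H²`. -/
noncomputable def weight (ε : ℝ) (p : ℝ × ℝ × ℝ) : ℝ :=
  Real.exp (ε * (2 * p.1 + p.2.1 - 4 * Real.log (potential 1 p) - 8 * Real.log (Real.cosh p.2.2)))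

theorem continuous_potential {κ : ℝ} : Continuous (potential κ) := by
  unfold potential
  fun_prop

theorem continuous_weight (ε : ℝ) : Continuous (weight ε) := by
  have h1 : ∀ p, potential 1 p ≠ 0 := fun p => (potential_pos p zero_le_one).ne'
  have h2 : ∀ p : ℝ × ℝ × ℝ, Real.cosh p.2.2 ≠ 0 := fun p => (Real.cosh_pos _).ne'
  have h3 : Continuous fun p => Real.log (potential 1 p) := continuous_potential.log h1
  have h4 : Continuous fun p : ℝ × ℝ × ℝ => Real.log (Real.cosh p.2.2) :=
    (Real.continuous_cosh.comp (by fun_prop)).log h2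
  unfold weight
  fun_prop

theorem integrable_exp_neg_mul_abs {c : ℝ} (hc : 0 < c) :
    Integrable fun x : ℝ => Real.exp (-(c * |x|)) := by
  have h1 : IntegrableOn (fun x : ℝ => Real.exp (-(c * |x|))) (Iic 0) :=
    (integrableOn_exp_mul_Iic hc 0).congr_fun (fun x hx => by
      simp only [abs_of_nonpos (mem_Iic.1 hx)]; ring_nf) measurableSet_Iic
  have h2 : IntegrableOn (fun x : ℝ => Real.exp (-(c * |x|))) (Ioi 0) :=
    (integrableOn_exp_mul_Ioi (neg_lt_zero.2 hc) 0).congr_fun (fun x hx => by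
      simp only [abs_of_pos (mem_Ioi.1 hx)]; ring_nf) measurableSet_Ioi
  have := h1.union h2
  rwa [Iic_union_Ioi, integrableOn_univ] at this

theorem integrable_weight {ε : ℝ} (hε : 0 < ε) : Integrable (weight ε) := by
  have hdom : Integrable fun p : ℝ × ℝ × ℝ => Real.exp (-(ε / 2 * |p.1|)) *
      (Real.exp (-(ε / 2 * |p.2.1|)) * Real.exp (-(ε * |p.2.2|))) :=
    (integrable_exp_neg_mul_abs (half_pos hε)).mul_prod
      ((integrable_exp_neg_mul_abs (half_pos hε)).mul_prod (integrable_exp_neg_mul_abs hε))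
  refine (hdom.const_mul (Real.exp (ε * (4 * Real.log 4 + 8 * Real.log 2)))).mono'
    (continuous_weight ε).aestronglyMeasurable (ae_of_all _ fun p => ?_)
  rw [weight, Real.norm_of_nonneg (Real.exp_pos _).le, ← Real.exp_add, ← Real.exp_add,
    ← Real.exp_add, Real.exp_le_exp]
  have l4 : 0 < Real.log 4 := Real.log_pos (by norm_num)
  have hv : p.1 - Real.log 4 ≤ Real.log (potential 1 p) := by
    rw [Real.le_log_iff_exp_le (potential_pos p zero_le_one), Real.exp_sub,
      Real.exp_log (by norm_num), potential]
    linarith [Real.exp_pos p.2.1]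
  have h0 : 0 ≤ Real.log (potential 1 p) := Real.log_nonneg (by
    rw [potential]; linarith [Real.exp_pos p.2.1, Real.exp_pos p.1])
  have hz : p.2.1 ≤ Real.log (potential 1 p) := by
    rw [Real.le_log_iff_exp_le (potential_pos p zero_le_one), potential]
    linarith [Real.exp_pos p.1]
  have hc : |p.2.2| - Real.log 2 ≤ Real.log (Real.cosh p.2.2) := by
    rw [Real.le_log_iff_exp_le (Real.cosh_pos _), Real.exp_sub, Real.exp_log (by norm_num),
      ← Real.cosh_abs, Real.cosh_eq]
    linarith [Real.exp_pos (-|p.2.2|)]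
  have key : 2 * p.1 + p.2.1 - 4 * Real.log (potential 1 p) - 8 * Real.log (Real.cosh p.2.2) ≤
      4 * Real.log 4 + 8 * Real.log 2 - |p.1| / 2 - |p.2.1| / 2 - |p.2.2| := by
    have := abs_nonneg p.2.2
    rcases abs_cases p.1 with ⟨e1, h1⟩ | ⟨e1, h1⟩ <;> rcases abs_cases p.2.1 with ⟨e2, h2⟩ | ⟨e2, h2⟩ <;>
      rw [e1, e2] <;> linarith
  calc _ ≤ ε * (4 * Real.log 4 + 8 * Real.log 2 - |p.1| / 2 - |p.2.1| / 2 - |p.2.2|) := by gcongr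
    _ = _ := by ring

/-- The growth of `weight` under a displacement of size `δ`, up to terms of second order. -/
theorem weight_add_ge {ε δ : ℝ} (hε : 0 ≤ ε) (hδ1 : 6 * δ ≤ 1) {p q : ℝ × ℝ × ℝ}
    (h1 : |q.1| ≤ 6 * δ) (h2 : |q.2.1| ≤ 6 * δ) (h3 : |q.2.2| ≤ 6 * δ) :
    (1 + ε * (2 * q.1 + q.2.1 - 4 * (wM 1 p * q.1 + wF 1 p * q.2.1)
      - 8 * (Real.tanh p.2.2 * q.2.2) - 432 * δ ^ 2)) * weight ε p ≤ weight ε (p + q) := by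
  have hp := potential_pos p zero_le_one
  have hpq := potential_pos (p + q) zero_le_one
  have hc := Real.cosh_pos p.2.2
  have hcq := Real.cosh_pos (p + q).2.2
  have hM := wM_pos p zero_le_one
  have hM1 := wM_le_one p zero_le_one
  have hF := wF_nonneg p zero_le_one
  have hF1 := wF_lt_one p zero_le_one
  have ht := abs_lt.1 (Real.abs_tanh_lt_one p.2.2)
  have sq : ∀ y, |y| ≤ 6 * δ → y ^ 2 ≤ 36 * δ ^ 2 := fun y hy => by
    have := sq_le_sq' (by linarith [(abs_le.1 hy).1]) (abs_le.1 hy).2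
    linarith
  have ex : ∀ y, |y| ≤ 6 * δ → Real.exp y ≤ 1 + y + 36 * δ ^ 2 := fun y hy => by
    have := (abs_le.1 (Real.abs_exp_sub_one_sub_id_le (hy.trans hδ1))).2
    linarith [sq y hy]
  have hlogZ : Real.log (potential 1 (p + q)) - Real.log (potential 1 p) ≤
      wM 1 p * q.1 + wF 1 p * q.2.1 + 36 * δ ^ 2 := by
    rw [← Real.log_div hpq.ne' hp.ne']
    refine (Real.log_le_sub_one_of_pos (div_pos hpq hp)).trans ?_
    have e : potential 1 (p + q) / potential 1 p - 1 =
        wM 1 p * (Real.exp q.1 - 1) + wF 1 p * (Real.exp q.2.1 - 1) := by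
      have e1 : potential 1 (p + q) = Real.exp p.1 / 4 * Real.exp q.1 + 1 +
          1 * Real.exp p.2.1 * Real.exp q.2.1 := by
        simp [potential, Real.exp_add]; ring
      rw [wM, wF, e1]
      field_simp
      rw [potential]
      ring
    rw [e]
    have a1 := mul_le_mul_of_nonneg_left (ex _ h1) hM.le
    have a2 := mul_le_mul_of_nonneg_left (ex _ h2) hF
    have a3 : wM 1 p + wF 1 p ≤ 1 := by linarith [w_sum p zero_le_one, wB_pos p zero_le_one]
    nlinarith [sq_nonneg δ]
  have hlogc : Real.log (Real.cosh (p + q).2.2) - Real.log (Real.cosh p.2.2) ≤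
      Real.tanh p.2.2 * q.2.2 + 36 * δ ^ 2 := by
    rw [← Real.log_div hcq.ne' hc.ne']
    refine (Real.log_le_sub_one_of_pos (div_pos hcq hc)).trans ?_
    have e : Real.cosh (p + q).2.2 / Real.cosh p.2.2 - 1 =
        (1 + Real.tanh p.2.2) / 2 * (Real.exp q.2.2 - 1) +
        (1 - Real.tanh p.2.2) / 2 * (Real.exp (-q.2.2) - 1) := by
      rw [Real.tanh_eq_sinh_div_cosh, Prod.snd_add, Prod.snd_add, Real.cosh_add,
        Real.cosh_eq q.2.2, Real.sinh_eq q.2.2]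
      field_simp
      ring
    rw [e]
    have a1 := mul_le_mul_of_nonneg_left (ex _ h3)
      (by linarith [ht.1] : 0 ≤ (1 + Real.tanh p.2.2) / 2)
    have a2 := mul_le_mul_of_nonneg_left (ex (-q.2.2) (by rwa [abs_neg]))
      (by linarith [ht.2] : 0 ≤ (1 - Real.tanh p.2.2) / 2)
    linarith
  have e : weight ε (p + q) = Real.exp (ε * (2 * q.1 + q.2.1
      - 4 * (Real.log (potential 1 (p + q)) - Real.log (potential 1 p))
      - 8 * (Real.log (Real.cosh (p + q).2.2) - Real.log (Real.cosh p.2.2)))) * weight ε p := by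
    rw [weight, weight, ← Real.exp_add]
    congr 1
    simp only [Prod.fst_add, Prod.snd_add]
    ring
  rw [e]
  refine mul_le_mul_of_nonneg_right ?_ (Real.exp_pos _).le
  refine le_trans ?_ (Real.add_one_le_exp _)
  rw [add_comm]
  have := mul_le_mul_of_nonneg_left (by linarith : 2 * q.1 + q.2.1
    - 4 * (wM 1 p * q.1 + wF 1 p * q.2.1) - 8 * (Real.tanh p.2.2 * q.2.2) - 432 * δ ^ 2 ≤
    2 * q.1 + q.2.1 - 4 * (Real.log (potential 1 (p + q)) - Real.log (potential 1 p))
      - 8 * (Real.log (Real.cosh (p + q).2.2) - Real.log (Real.cosh p.2.2))) hε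
  linarith

variable {s : ℝ}

/-- The Jacobian of a backward Euler step, up to terms of second order. -/
theorem det_euler_ge (hs0 : 0 < s) (hs4 : s < 4) {κ δ : ℝ} (hκ : 0 ≤ κ) (p : ℝ × ℝ × ℝ) :
    1 - δ * accelX κ s p - 80 * δ ^ 2 ≤
      (ContinuousLinearMap.id ℝ (ℝ × ℝ × ℝ) + δ • -fieldDeriv κ s p).det := by
  set y := 1 - Real.tanh p.2.2 ^ 2 with hy
  have hy0 : 0 ≤ y := by linarith [Real.tanh_sq_lt_one p.2.2]
  have hy1 : y ≤ 1 := by rw [hy]; nlinarith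
  have e : ContinuousLinearMap.id ℝ (ℝ × ℝ × ℝ) + δ • -fieldDeriv κ s p =
      (dv + (6 * δ * y) • dχ).prod ((dζ + (-(2 * δ * y)) • dχ).prod
        ((-(δ * accelV κ s p)) • dv + (-(δ * accelZ κ s p)) • dζ
          + (1 - δ * accelX κ s p) • dχ)) := by
    refine ContinuousLinearMap.ext fun q => ?_
    refine Prod.ext ?_ (Prod.ext ?_ ?_)
    · simp [fieldDeriv]; ring
    · simp [fieldDeriv]; ring
    · simp [fieldDeriv]; ring
  rw [e, det_eq]
  have hV := abs_le.1 (abs_accelV_le p hκ hs0 hs4)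
  have hZ := abs_le.1 (abs_accelZ_le p hκ hs0 hs4)
  have b1 : -10 ≤ y * accelV κ s p := by nlinarith
  have b2 : y * accelZ κ s p ≤ 10 := by nlinarith
  nlinarith [sq_nonneg δ, mul_le_mul_of_nonneg_left b1 (sq_nonneg δ),
    mul_le_mul_of_nonneg_left b2 (sq_nonneg δ)]

/-- The divergence of the weighted field, with the opposite sign, at a point with `χ = artanh x` and
density fraction `F`: it is bounded from below where `x` is not too negative. The bound `s / 68` is chosen
such that `(18 + 16) (s / 68) = s / 2`. -/
theorem neg_div_weight_ge (hs0 : 0 < s) (hs4 : s < 4) {ε x F : ℝ} (hε0 : 0 < ε)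
    (hε : 8 * ε ≤ 1 - s / 4) (hx0 : -(s / 68) ≤ x) (hx1 : x < 1) (hF0 : 0 ≤ F) (hF1 : F ≤ 1) :
    ε * s / 2 ≤ (2 - s / 2 * F) * (1 - x ^ 2) +
      ε * (18 * x - 16 * x ^ 2 + s - 4 * s * F * (1 - x ^ 2)) ∧
    |18 * x - 16 * x ^ 2 + s - 4 * s * F * (1 - x ^ 2)| ≤ 60 := by
  have hx2 : 0 ≤ 1 - x ^ 2 := by nlinarith
  have hx3 : 1 - x ^ 2 ≤ 1 := by linarith [sq_nonneg x]
  have hxx : -(s / 2) ≤ 18 * x - 16 * x ^ 2 := by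
    rcases le_total 0 x with h | h
    · nlinarith [mul_nonneg h (sub_nonneg.2 hx1.le)]
    · nlinarith [mul_nonneg (neg_nonneg.2 h) (by linarith : 0 ≤ x + 1)]
  have hxx1 : 18 * x - 16 * x ^ 2 ≤ 18 := by linarith [sq_nonneg x]
  have hsF0 : 0 ≤ 4 * s * F * (1 - x ^ 2) := by positivity
  have hsF : 4 * s * F * (1 - x ^ 2) ≤ 4 * 4 * 1 * 1 := by gcongr
  constructor
  · have h1 : (2 - s / 2) * (1 - x ^ 2) ≤ (2 - s / 2 * F) * (1 - x ^ 2) := by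
      gcongr
      nlinarith
    have h2 : ε * (4 * s * F * (1 - x ^ 2)) ≤ (2 - s / 2) * (1 - x ^ 2) := by
      rw [← mul_assoc]
      gcongr
      calc ε * (4 * s * F) ≤ ε * (4 * 4 * 1) := by gcongr
        _ ≤ 2 - s / 2 := by linarith
    have h3 : ε * (-(s / 2)) ≤ ε * (18 * x - 16 * x ^ 2) := by gcongr
    linarith
  · rw [abs_le]
    constructor <;> linarith

/-- The terms of second order in the growth of the measure under an Euler step of length `δ` are
absorbed by half of the term of first order. -/
theorem one_add_le_mul_of_small {ε δ D y : ℝ} (hε0 : 0 < ε) (hε1 : ε ≤ 1) (hδ0 : 0 < δ)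
    (hδ1 : 1000 * δ ≤ 1) (hδ : 4000 * δ ≤ ε * s) (hD0 : 0 ≤ D) (hD2 : D ≤ 2) (hy : |ε * y| ≤ 60)
    (hdiv : ε * s / 2 ≤ D + ε * y) :
    1 + ε * s / 4 * δ ≤ (1 + δ * D - 80 * δ ^ 2) * (1 + ε * (δ * y - 432 * δ ^ 2)) := by
  obtain ⟨hy0, hy1⟩ := abs_le.1 hy
  have e : (1 + δ * D - 80 * δ ^ 2) * (1 + ε * (δ * y - 432 * δ ^ 2)) =
      1 + δ * (D + ε * y) - δ ^ 2 * (80 + 432 * ε) + δ ^ 2 * (D * (ε * y))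
      - δ ^ 3 * (432 * ε * D + 80 * (ε * y)) + 80 * 432 * ε * δ ^ 4 := by ring
  have t1 : -120 ≤ D * (ε * y) := by nlinarith
  have t2 : 432 * ε * D + 80 * (ε * y) ≤ 6000 := by nlinarith
  have t3 : δ ^ 3 * (432 * ε * D + 80 * (ε * y)) ≤ δ ^ 2 * 6 := by
    calc δ ^ 3 * (432 * ε * D + 80 * (ε * y)) ≤ δ ^ 3 * 6000 := by gcongr
      _ = δ ^ 2 * (6 * (1000 * δ)) := by ring
      _ ≤ δ ^ 2 * 6 := by gcongr; linarith
  have t4 : 0 ≤ 80 * 432 * ε * δ ^ 4 := by positivity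
  have t5 : δ ^ 2 * (-120) ≤ δ ^ 2 * (D * (ε * y)) := by gcongr
  have t6 : δ ^ 2 * (80 + 432 * ε) ≤ δ ^ 2 * 512 := by gcongr; linarith
  have t7 : δ * (ε * s / 2) ≤ δ * (D + ε * y) := by gcongr
  have t8 : δ * (4000 * δ) ≤ δ * (ε * s) := by gcongr
  rw [e]
  nlinarith

/-- A backward Euler step expands `weight` where `χ` is not too negative: the divergence of the
weighted field is negative there. -/
theorem weight_euler_ge (hs0 : 0 < s) (hs4 : s < 4) {ε δ : ℝ} (hε0 : 0 < ε) (hε1 : ε ≤ 1)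
    (hε : 8 * ε ≤ 1 - s / 4) (hδ0 : 0 < δ) (hδ : 4000 * δ ≤ ε * s) {p : ℝ × ℝ × ℝ}
    (hp : -(s / 68) ≤ Real.tanh p.2.2) :
    (1 + ε * s / 4 * δ) * weight ε p ≤
      |(ContinuousLinearMap.id ℝ (ℝ × ℝ × ℝ) + δ • -fieldDeriv 1 s p).det| *
        weight ε (p + δ • -field 1 s p) := by
  set x := Real.tanh p.2.2 with hx
  have hx1 := abs_lt.1 (Real.abs_tanh_lt_one p.2.2)
  rw [← hx] at hx1
  have hδ1 : 1000 * δ ≤ 1 := by nlinarith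
  have hG := abs_le.1 (abs_accel_le p zero_le_one hs0 hs4)
  have hM := wM_pos p zero_le_one
  have hB := wB_pos p zero_le_one
  have hF := wF_nonneg p zero_le_one
  have hsum := w_sum p zero_le_one
  have hw := weight_add_ge (ε := ε) (δ := δ) hε0.le (by linarith) (p := p)
    (q := δ • -field 1 s p)
    (by
      simp only [field, Prod.smul_fst, Prod.fst_neg, smul_eq_mul, ← hx]
      rw [abs_mul, abs_of_pos hδ0, mul_comm, abs_neg]
      gcongr
      rw [abs_le]; constructor <;> linarith)
    (by
      simp only [field, Prod.smul_fst, Prod.fst_neg, Prod.smul_snd, Prod.snd_neg, smul_eq_mul, ← hx]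
      rw [abs_mul, abs_of_pos hδ0, mul_comm, abs_neg]
      gcongr
      rw [abs_le]; constructor <;> linarith)
    (by
      simp only [field, Prod.smul_snd, Prod.snd_neg, smul_eq_mul]
      rw [abs_mul, abs_of_pos hδ0, mul_comm, abs_neg]
      gcongr
      exact abs_accel_le p zero_le_one hs0 hs4)
  have hd := det_euler_ge hs0 hs4 (δ := δ) zero_le_one p
  set d := (ContinuousLinearMap.id ℝ (ℝ × ℝ × ℝ) + δ • -fieldDeriv 1 s p).det
  set y₀ : ℝ := 18 * x - 16 * x ^ 2 + s - 4 * s * wF 1 p * (1 - x ^ 2) with hy₀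
  have ey : 2 * (δ • -field 1 s p).1 + (δ • -field 1 s p).2.1 - 4 * (wM 1 p * (δ • -field 1 s p).1 +
      wF 1 p * (δ • -field 1 s p).2.1) - 8 * (x * (δ • -field 1 s p).2.2) - 432 * δ ^ 2 =
      δ * y₀ - 432 * δ ^ 2 := by
    simp only [field, accel, Prod.smul_fst, Prod.fst_neg, Prod.smul_snd, Prod.snd_neg, smul_eq_mul,
      ← hx, hy₀]
    linear_combination 8 * δ * x * hsum
  rw [ey] at hw
  set D := -accelX 1 s p with hD
  have hD0 : 0 ≤ D ∧ D ≤ 2 := by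
    have := accelX_mem p zero_le_one hs0 hs4
    constructor <;> linarith
  obtain ⟨hdiv, hy1⟩ : ε * s / 2 ≤ D + ε * y₀ ∧ |y₀| ≤ 60 := by
    have := neg_div_weight_ge hs0 hs4 hε0 hε hp hx1.2 hF (wF_lt_one p zero_le_one).le
    refine ⟨this.1.trans (le_of_eq ?_), this.2⟩
    rw [hD, accelX]
    ring
  set A := 1 + δ * D - 80 * δ ^ 2
  set C := 1 + ε * (δ * y₀ - 432 * δ ^ 2)
  have hA1 : A ≤ d := by simp only [A, hD]; linarith
  have hA0 : 0 ≤ A := by simp only [A]; nlinarith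
  have hC : 1 + ε * s / 4 * δ ≤ A * C := by
    have hy := abs_le.1 hy1
    have hyε : |ε * y₀| ≤ 60 := by
      rw [abs_mul, abs_of_pos hε0]
      nlinarith [abs_nonneg y₀]
    have := one_add_le_mul_of_small hε0 hε1 hδ0 hδ1 hδ hD0.1 hD0.2 hyε hdiv
    simp only [A, C]
    linarith
  calc (1 + ε * s / 4 * δ) * weight ε p ≤ A * C * weight ε p := by
        have := Real.exp_pos (ε * (2 * p.1 + p.2.1 - 4 * Real.log (potential 1 p)
          - 8 * Real.log (Real.cosh p.2.2)))
        rw [weight]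
        gcongr
    _ = A * (C * weight ε p) := by ring
    _ ≤ A * weight ε (p + δ • -field 1 s p) := by gcongr
    _ ≤ |d| * weight ε (p + δ • -field 1 s p) := by
        have : 0 ≤ weight ε (p + δ • -field 1 s p) := (Real.exp_pos _).le
        gcongr
        exact hA1.trans (le_abs_self d)

/-- Almost every fluid orbit has negative shear at some time in the past: the flow contracts a finite
measure with positive density as long as the shear is not negative. -/
theorem volume_forall_nonneg_eq_zero (hs0 : 0 < s) (hs4 : s < 4) {φ : ℝ → ℝ × ℝ × ℝ → ℝ × ℝ × ℝ}
    (hφ : IsGlobalFlow (field 1 s) φ) :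
    volume {p : ℝ × ℝ × ℝ | ∀ t ≤ 0, 0 ≤ (φ t p).2.2} = 0 := by
  obtain ⟨ε, hε0, hε⟩ : ∃ ε : ℝ, 0 < ε ∧ 8 * ε ≤ 1 - s / 4 :=
    ⟨(1 - s / 4) / 8, by linarith, by linarith⟩
  set μ : Measure (ℝ × ℝ × ℝ) := volume.withDensity fun p => ENNReal.ofReal (weight ε p) with hμ
  have : (volume : Measure (ℝ × ℝ × ℝ)).IsAddHaarMeasure := Measure.prod.instIsAddHaarMeasure _ _
  have : IsFiniteMeasure μ := isFiniteMeasure_withDensity_ofReal (integrable_weight hε0).2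
  have hlip := lipschitzWith_field zero_le_one hs0 hs4
  have hμ0 := hφ.reverse.measure_forall_mem_eq_zero (μ := μ) (K := 22) (B := 6) (c := ε * s / 4)
    (η := s / 68) (δ₀ := ε * s / 4000) (S := {p | 0 ≤ p.2.2}) hlip.neg
    (fun p => by rw [norm_neg]; exact norm_field_le p zero_le_one hs0 hs4) (by positivity)
    (by positivity) (by positivity) (fun δ hδ0 hδ A hA hAS => by
      have hδ' : 4000 * δ ≤ ε * s := by linarith
      have hδ1 : 1000 * δ ≤ 1 := by nlinarith
      refine withDensity_mul_real_le_real_image (ν := volume) (by positivity) hA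
        (W := weight ε) (ψ := fun p => p + δ • -field 1 s p)
        (ψ' := fun p => ContinuousLinearMap.id ℝ (ℝ × ℝ × ℝ) + δ • -fieldDeriv 1 s p)
        (fun p _ => ?_) (fun p _ q _ hpq => ?_) fun p hp => ?_
      · exact ((hasFDerivAt_id p).fun_add
          ((hasFDerivAt_field p zero_le_one).fun_neg.fun_const_smul δ)).hasFDerivWithinAt
      · have h1 : p - q = δ • (field 1 s p - field 1 s q) := by
          have : p + δ • -field 1 s p = q + δ • -field 1 s q := hpq
          rw [smul_neg, smul_neg, ← sub_eq_add_neg, ← sub_eq_add_neg, sub_eq_sub_iff_add_eq_add] at this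
          rw [smul_sub, sub_eq_sub_iff_add_eq_add, this, add_comm]
        have h2 : ‖p - q‖ ≤ δ * (22 * ‖p - q‖) := by
          conv_lhs => rw [h1]
          rw [norm_smul, Real.norm_of_nonneg hδ0.le]
          gcongr
          exact hlip.norm_sub_le p q
        have h3 : ‖p - q‖ = 0 := le_antisymm (by nlinarith [norm_nonneg (p - q)]) (norm_nonneg _)
        exact sub_eq_zero.1 (norm_eq_zero.1 h3)
      · refine weight_euler_ge hs0 hs4 hε0 (by linarith) hε hδ0 hδ' ?_
        obtain ⟨q, hq, hpq⟩ := Metric.mem_thickening_iff.1 (hAS hp)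
        have h1 : |p.2.2 - q.2.2| < s / 68 :=
          lt_of_le_of_lt ((norm_snd_le (p - q).2).trans (norm_snd_le (p - q)))
            (by rwa [← dist_eq_norm])
        have h2 : -(s / 68) ≤ p.2.2 := by
          have := (abs_lt.1 h1).1
          have hq' : 0 ≤ q.2.2 := hq
          linarith
        have hlipt : LipschitzWith 1 Real.tanh := lipschitzWith_of_nnnorm_deriv_le
          (fun y => (Real.hasDerivAt_tanh y).differentiableAt) fun y => by
            rw [(Real.hasDerivAt_tanh y).deriv, ← NNReal.coe_le_coe, coe_nnnorm, Real.norm_eq_abs,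
              abs_of_nonneg (by linarith [Real.tanh_sq_lt_one y]), NNReal.coe_one]
            linarith [sq_nonneg (Real.tanh y)]
        rcases le_total 0 p.2.2 with h | h
        · have : 0 ≤ Real.tanh p.2.2 := by
            rw [Real.tanh_eq_sinh_div_cosh]
            exact div_nonneg (Real.sinh_nonneg_iff.2 h) (Real.cosh_pos _).le
          linarith
        · have := hlipt.norm_sub_le p.2.2 0
          simp only [Real.tanh_zero, sub_zero, NNReal.coe_one, one_mul, Real.norm_eq_abs,
            abs_of_nonpos h] at this
          linarith [(abs_le.1 this).1])
    (isClosed_le continuous_const (by fun_prop))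
  have hac : (volume : Measure (ℝ × ℝ × ℝ)) ≪ μ :=
    withDensity_absolutelyContinuous'
      (continuous_weight ε).measurable.ennreal_ofReal.aemeasurable
      (ae_of_all _ fun p => (ENNReal.ofReal_pos.2 (Real.exp_pos _)).ne')
  refine measure_mono_null ?_ (hac hμ0)
  intro p hp t ht
  exact hp (-t) (by linarith)

end Reduced

/-! ### Real functions with controlled derivatives -/

theorem tendsto_atBot_of_le_deriv {f f' : ℝ → ℝ} {c t₀ : ℝ} (hc : 0 < c)
    (hf : ∀ t, HasDerivAt f (f' t) t) (h : ∀ t ≤ t₀, c ≤ f' t) : Tendsto f atBot atBot := by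
  have hle : ∀ t ≤ t₀, f t ≤ f t₀ - c * (t₀ - t) := by
    intro t ht
    have := (convex_Iic t₀).mul_sub_le_image_sub_of_le_deriv
      (fun t _ => (hf t).continuousAt.continuousWithinAt)
      (fun t _ => (hf t).differentiableAt.differentiableWithinAt) (C := c)
      (fun u hu => by
        have hu' : u ∈ Iic t₀ := interior_subset hu
        rw [(hf u).deriv]; exact h u hu') t ht t₀ self_mem_Iic ht
    linarith
  refine tendsto_atBot_mono' atBot (eventually_atBot.2 ⟨t₀, hle⟩) ?_
  refine tendsto_atBot_add_const_left atBot _ (tendsto_neg_atTop_atBot.comp ?_)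
  exact (tendsto_atTop_add_const_left atBot t₀ tendsto_neg_atBot_atTop).const_mul_atTop hc

theorem abs_sub_le_of_abs_deriv_le {f f' : ℝ → ℝ} {K : ℝ} (hf : ∀ t, HasDerivAt f (f' t) t)
    (h : ∀ t, |f' t| ≤ K) (t u : ℝ) : |f t - f u| ≤ K * |t - u| :=
  convex_univ.norm_image_sub_le_of_norm_hasDerivWithin_le
    (fun t _ => (hf t).hasDerivWithinAt) (fun t _ => h t) (mem_univ u) (mem_univ t)

/-- Barbalat's lemma: a Lipschitz lower bound of the derivative of a convergent function is eventually
small. -/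
theorem eventually_lt_of_tendsto_of_le_deriv {P P' G : ℝ → ℝ} {K L ε : ℝ}
    (hP : ∀ t, HasDerivAt P (P' t) t) (hG : ∀ t, G t ≤ P' t)
    (hK : ∀ t u, |G t - G u| ≤ K * |t - u|) (hL : Tendsto P atTop (𝓝 L)) (hε : 0 < ε) :
    ∀ᶠ t in atTop, G t < ε := by
  have hK0 : 0 ≤ K := by
    have := (abs_nonneg _).trans (hK 1 0)
    simpa using this
  set h : ℝ := ε / (2 * (K + 1)) with hh
  have h0 : 0 < h := by positivity
  have hKh : K * h < ε / 2 := by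
    rw [hh, mul_div_assoc', div_lt_div_iff₀ (by positivity) (by positivity)]
    nlinarith
  have hdiff : Tendsto (fun t => P (t + h) - P t) atTop (𝓝 0) := by
    simpa using (hL.comp (tendsto_atTop_add_const_right atTop h tendsto_id)).sub hL
  filter_upwards [hdiff.eventually_lt_const (by positivity : 0 < h * (ε / 2))] with t ht
  have := (convex_Icc t (t + h)).mul_sub_le_image_sub_of_le_deriv
    (fun t _ => (hP t).continuousAt.continuousWithinAt)
    (fun t _ => (hP t).differentiableAt.differentiableWithinAt) (C := G t - K * h)
    (fun u hu => by
      rw [(hP u).deriv]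
      refine le_trans ?_ (hG u)
      have hu' := interior_subset hu
      have h1 := (abs_le.1 (hK t u)).2
      have h2 : |t - u| ≤ h := abs_le.2 ⟨by linarith [hu'.2], by linarith [hu'.1]⟩
      nlinarith) t ⟨le_rfl, by linarith⟩ (t + h) ⟨by linarith, le_rfl⟩ (by linarith)
  nlinarith

theorem tendsto_zero_of_tendsto_of_lipschitz_deriv {P P' : ℝ → ℝ} {K L : ℝ}
    (hP : ∀ t, HasDerivAt P (P' t) t) (hK : ∀ t u, |P' t - P' u| ≤ K * |t - u|)
    (hL : Tendsto P atTop (𝓝 L)) : Tendsto P' atTop (𝓝 0) := by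
  rw [Metric.tendsto_nhds]
  intro ε hε
  have h1 := eventually_lt_of_tendsto_of_le_deriv hP (fun _ => le_rfl) hK hL hε
  have h2 := eventually_lt_of_tendsto_of_le_deriv (fun t => (hP t).fun_neg) (fun _ => le_rfl)
    (fun t u => by rw [neg_sub_neg, abs_sub_comm]; exact hK t u) hL.neg hε
  filter_upwards [h1, h2] with t ht1 ht2
  rw [Real.dist_eq, sub_zero, abs_lt]
  exact ⟨by linarith, ht1⟩

theorem exists_tendsto_of_deriv_nonneg_of_le {P P' : ℝ → ℝ} {C : ℝ}
    (hP : ∀ t, HasDerivAt P (P' t) t) (h0 : ∀ t, 0 ≤ P' t) (hC : ∀ t, P t ≤ C) :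
    ∃ L, Tendsto P atTop (𝓝 L) :=
  ⟨_, tendsto_atTop_ciSup (monotone_of_deriv_nonneg (fun t => (hP t).differentiableAt)
    fun t => by rw [(hP t).deriv]; exact h0 t) ⟨C, by rintro _ ⟨t, rfl⟩; exact hC t⟩⟩

/-! ### Asymptotics of the reduced flow -/

namespace Reduced

variable (κ s : ℝ) (p : ℝ × ℝ × ℝ)

/-- `m₁² / (12 H²)`. -/
noncomputable def nM : ℝ := wM κ p * (1 - Real.tanh p.2.2 ^ 2)

/-- `1 / (3 g₂₂ H²)`. -/
noncomputable def nB : ℝ := wB κ p * (1 - Real.tanh p.2.2 ^ 2)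

/-- `ρ / (3 H²)`. -/
noncomputable def nF : ℝ := wF κ p * (1 - Real.tanh p.2.2 ^ 2)

/-- The deceleration parameter. -/
noncomputable def decel : ℝ := 2 * Real.tanh p.2.2 ^ 2 + s / 2 * nF κ p

/-- The state `(H_D, Σ₊, M₁)` as a function of `(v, ζ, χ)`. -/
noncomputable def toState : ℝ × ℝ × ℝ :=
  (1 / √(1 - nB κ p), Real.tanh p.2.2 / √(1 - nB κ p), √(12 * nM κ p) / √(1 - nB κ p))

variable {κ s : ℝ} (hκ : 0 ≤ κ)

include hκ in
theorem nM_pos : 0 < nM κ p := mul_pos (wM_pos p hκ) (by linarith [Real.tanh_sq_lt_one p.2.2])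

include hκ in
theorem nB_pos : 0 < nB κ p := mul_pos (wB_pos p hκ) (by linarith [Real.tanh_sq_lt_one p.2.2])

include hκ in
theorem nF_nonneg : 0 ≤ nF κ p :=
  mul_nonneg (wF_nonneg p hκ) (by linarith [Real.tanh_sq_lt_one p.2.2])

include hκ in
/-- The Hamiltonian constraint. -/
theorem n_sum : nM κ p + nB κ p + nF κ p = 1 - Real.tanh p.2.2 ^ 2 := by
  unfold nM nB nF
  linear_combination (1 - Real.tanh p.2.2 ^ 2) * w_sum p hκ

include hκ in
theorem nB_lt_one : nB κ p < 1 := by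
  linarith [n_sum p hκ, nM_pos p hκ, nF_nonneg p hκ, sq_nonneg (Real.tanh p.2.2)]

theorem nM_eq : nM κ p = Real.exp p.1 / 4 * nB κ p := by
  rw [nM, nB, wM_eq]; ring

/-- In the coordinates `(r, θ, Σ₊)` the angle depends only on `v = log (g₁₁ / g₂₂)`. -/
theorem toY_toState (hκ : 0 ≤ κ) : toY (toState κ p) =
    (nB κ p / (2 * (1 - nB κ p)) * √(1 + 4 * Real.exp p.1 ^ 2),
      Real.arccos (-(√(1 + 4 * Real.exp p.1 ^ 2))⁻¹), Real.tanh p.2.2 / √(1 - nB κ p)) := by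
  have hb := nB_pos p hκ
  have hb1 : 0 < 1 - nB κ p := by linarith [nB_lt_one p hκ]
  have hm := nM_pos p hκ
  have e1 : (1 - (1 / √(1 - nB κ p)) ^ 2) / 2 = -(nB κ p / (2 * (1 - nB κ p))) := by
    rw [div_pow, Real.sq_sqrt hb1.le]
    field_simp
    ring
  have e2 : (√(12 * nM κ p) / √(1 - nB κ p)) ^ 2 / 3 =
      nB κ p / (2 * (1 - nB κ p)) * (2 * Real.exp p.1) := by
    rw [div_pow, Real.sq_sqrt hb1.le, Real.sq_sqrt (by positivity), nM_eq]
    field_simp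
    ring
  have hr : coordR (toState κ p) =
      nB κ p / (2 * (1 - nB κ p)) * √(1 + 4 * Real.exp p.1 ^ 2) := by
    rw [coordR, toState, e1, e2, ← Real.sqrt_sq (by positivity : 0 ≤ nB κ p / (2 * (1 - nB κ p))),
      ← Real.sqrt_mul (by positivity)]
    congr 1
    rw [Real.sqrt_sq (by positivity)]
    ring
  rw [toY, hr, coordTheta, hr]
  refine Prod.ext rfl (Prod.ext ?_ rfl)
  have e3 : (1 - (toState κ p).1 ^ 2) = 2 * -(nB κ p / (2 * (1 - nB κ p))) := by
    rw [toState, ← e1]; ring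
  simp only [e3]
  congr 1
  have : 0 < √(1 + 4 * Real.exp p.1 ^ 2) := Real.sqrt_pos.2 (by positivity)
  field_simp

section Curve

variable {γ : ℝ → ℝ × ℝ × ℝ} (hγ : ∀ t, HasDerivAt γ (field κ s (γ t)) t)

include hγ in
theorem hasDerivAt_v (t : ℝ) : HasDerivAt (fun t => (γ t).1) (-6 * Real.tanh (γ t).2.2) t :=
  dv.hasFDerivAt.comp_hasDerivAt t (hγ t)

include hγ in
theorem hasDerivAt_χ (t : ℝ) : HasDerivAt (fun t => (γ t).2.2) (accel κ s (γ t)) t :=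
  dχ.hasFDerivAt.comp_hasDerivAt t (hγ t)

theorem one_sub_sq_mul_accel : (1 - Real.tanh p.2.2 ^ 2) * accel κ s p =
    -(2 - decel κ s p) * Real.tanh p.2.2 + 4 * nM κ p + nB κ p := by
  unfold accel decel nM nB nF
  ring

include hγ in
theorem hasDerivAt_x (t : ℝ) : HasDerivAt (fun t => Real.tanh (γ t).2.2)
    (-(2 - decel κ s (γ t)) * Real.tanh (γ t).2.2 + 4 * nM κ (γ t) + nB κ (γ t)) t := by
  rw [← one_sub_sq_mul_accel]
  exact (Real.hasDerivAt_tanh _).comp t (hasDerivAt_χ hγ t)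

include hκ hγ in
theorem hasDerivAt_nM (t : ℝ) : HasDerivAt (fun t => nM κ (γ t))
    (nM κ (γ t) * (2 * decel κ s (γ t) - 8 * Real.tanh (γ t).2.2)) t := by
  have h := ((hasFDerivAt_wM (γ t) hκ).comp_hasDerivAt t (hγ t)).fun_mul
    (((hasDerivAt_x hγ t).fun_pow 2).const_sub 1)
  refine h.congr_deriv ?_
  have hs := w_sum (γ t) hκ
  simp [field, decel, nM, nF, nB]
  linear_combination (-2 * wM κ (γ t) * Real.tanh (γ t).2.2 * (1 - Real.tanh (γ t).2.2 ^ 2)) * hs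

include hκ hγ in
theorem hasDerivAt_nB (t : ℝ) : HasDerivAt (fun t => nB κ (γ t))
    (nB κ (γ t) * (2 * decel κ s (γ t) - 2 * Real.tanh (γ t).2.2)) t := by
  have h := ((hasFDerivAt_wB (γ t) hκ).comp_hasDerivAt t (hγ t)).fun_mul
    (((hasDerivAt_x hγ t).fun_pow 2).const_sub 1)
  refine h.congr_deriv ?_
  have hs := w_sum (γ t) hκ
  simp [field, decel, nM, nF, nB]
  linear_combination (-2 * wB κ (γ t) * Real.tanh (γ t).2.2 * (1 - Real.tanh (γ t).2.2 ^ 2)) * hs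

include hκ hγ in
theorem hasDerivAt_nF (t : ℝ) : HasDerivAt (fun t => nF κ (γ t))
    (nF κ (γ t) * (2 * decel κ s (γ t) - s)) t := by
  have h := ((hasFDerivAt_wF (γ t) hκ).comp_hasDerivAt t (hγ t)).fun_mul
    (((hasDerivAt_x hγ t).fun_pow 2).const_sub 1)
  refine h.congr_deriv ?_
  have hs := w_sum (γ t) hκ
  simp [field, decel, nM, nF, nB]
  linear_combination (-2 * wF κ (γ t) * Real.tanh (γ t).2.2 * (1 - Real.tanh (γ t).2.2 ^ 2)) * hs

end Curve

end Reduced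

namespace Reduced

variable {κ s : ℝ} {γ : ℝ → ℝ × ℝ × ℝ}

/-! ### The past of an orbit with negative shear -/

theorem tanh_lt_zero_iff {y : ℝ} : Real.tanh y < 0 ↔ y < 0 := by
  rw [Real.tanh_eq_sinh_div_cosh, div_neg_iff]
  have := Real.cosh_pos y
  rw [Real.sinh_neg_iff]
  constructor
  · rintro (h | h)
    · linarith
    · exact h.1
  · exact fun h => Or.inr ⟨h, this⟩

theorem strictMono_tanh : StrictMono Real.tanh := by
  refine strictMono_of_deriv_pos fun y => ?_
  rw [(Real.hasDerivAt_tanh y).deriv]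
  linarith [Real.tanh_sq_lt_one y]

/-- Where the shear is negative, the shear grows. -/
theorem le_accel (hκ : 0 ≤ κ) (hs0 : 0 < s) (hs4 : s < 4) {p : ℝ × ℝ × ℝ} {c : ℝ} (hc : 0 ≤ c)
    (hp : Real.tanh p.2.2 ≤ -c) : (2 - s / 2) * c ≤ accel κ s p := by
  have h1 := wM_pos p hκ
  have h2 := wB_pos p hκ
  have h3 := wF_nonneg p hκ
  have h4 := wF_lt_one p hκ
  have h5 : 2 - s / 2 ≤ 2 - s / 2 * wF κ p := by nlinarith
  have h6 : (2 - s / 2) * c ≤ (2 - s / 2 * wF κ p) * -Real.tanh p.2.2 :=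
    mul_le_mul h5 (by linarith) hc (by linarith)
  unfold accel
  linarith

theorem χ_le_of_neg (hκ : 0 ≤ κ) (hs0 : 0 < s) (hs4 : s < 4)
    (hγ : ∀ t, HasDerivAt γ (field κ s (γ t)) t) {t₀ : ℝ} (h0 : (γ t₀).2.2 < 0) {t : ℝ}
    (ht : t ≤ t₀) : (γ t).2.2 ≤ (γ t₀).2.2 := by
  have hd : ∀ u, HasDerivAt (fun u => (γ (t₀ - u)).2.2) (-accel κ s (γ (t₀ - u))) u := fun u => by
    have := (hasDerivAt_χ hγ (t₀ - u)).comp u ((hasDerivAt_id u).const_sub t₀)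
    simpa [Function.comp_def] using this
  have := image_le_of_deriv_right_lt_deriv_boundary' (f := fun u => (γ (t₀ - u)).2.2) (a := 0)
    (b := t₀ - t) (B := fun _ => (γ t₀).2.2) (B' := fun _ => 0)
    (fun u _ => (hd u).continuousAt.continuousWithinAt) (fun u _ => (hd u).hasDerivWithinAt)
    (by simp) continuousOn_const (fun u _ => hasDerivWithinAt_const _ _ _)
    (fun u _ hu => by
      have hneg : Real.tanh (γ (t₀ - u)).2.2 < 0 := tanh_lt_zero_iff.2 (by linarith [hu])
      have := le_accel hκ hs0 hs4 (p := γ (t₀ - u)) (c := -Real.tanh (γ (t₀ - u)).2.2)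
        (by linarith) (by linarith)
      have h2 : 0 < (2 - s / 2) * -Real.tanh (γ (t₀ - u)).2.2 := by
        apply mul_pos <;> linarith
      linarith) (x := t₀ - t) ⟨by linarith, le_rfl⟩
  simpa using this

/-- Once the shear is negative, `χ` and `v` tend to `-∞` at least linearly in the past. -/
theorem tendsto_pointTflat (hκ : 0 ≤ κ) (hs0 : 0 < s) (hs4 : s < 4)
    (hγ : ∀ t, HasDerivAt γ (field κ s (γ t)) t) {t₀ : ℝ} (h0 : (γ t₀).2.2 < 0) :
    Tendsto (fun t => toY (toState κ (γ t))) atBot (𝓝 pointTflat) := by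
  set c := -Real.tanh (γ t₀).2.2 with hc
  have hc0 : 0 < c := by
    have := tanh_lt_zero_iff.2 h0
    linarith
  have hx : ∀ t ≤ t₀, Real.tanh (γ t).2.2 ≤ -c := fun t ht => by
    rw [hc, neg_neg]
    exact strictMono_tanh.monotone (χ_le_of_neg hκ hs0 hs4 hγ h0 ht)
  have hχ : Tendsto (fun t => (γ t).2.2) atBot atBot :=
    tendsto_atBot_of_le_deriv (c := (2 - s / 2) * c) (mul_pos (by linarith) hc0)
      (fun t => hasDerivAt_χ hγ t) fun t ht => le_accel hκ hs0 hs4 hc0.le (hx t ht)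
  have hv : Tendsto (fun t => (γ t).1) atBot atBot :=
    tendsto_atBot_of_le_deriv (c := 6 * c) (by positivity) (fun t => hasDerivAt_v hγ t)
      fun t ht => by linarith [hx t ht]
  have htanh : Tendsto Real.tanh atBot (𝓝 (-1)) := by
    have h1 : Tendsto (fun y : ℝ => Real.exp y ^ 2) atBot (𝓝 0) := by
      simpa using Real.tendsto_exp_atBot.pow 2
    have h2 : Tendsto (fun y : ℝ => (Real.exp y ^ 2 - 1) / (Real.exp y ^ 2 + 1)) atBot (𝓝 (-1)) := by
      have := (h1.sub_const 1).div (h1.add_const 1) (by norm_num)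
      simpa [Pi.div_def] using this
    refine h2.congr fun y => ?_
    rw [Real.tanh_eq, Real.exp_neg]
    have := Real.exp_pos y
    field_simp
  have hxl : Tendsto (fun t => Real.tanh (γ t).2.2) atBot (𝓝 (-1)) := htanh.comp hχ
  have hb : Tendsto (fun t => nB κ (γ t)) atBot (𝓝 0) := by
    have h1 : Tendsto (fun t => 1 - Real.tanh (γ t).2.2 ^ 2) atBot (𝓝 0) := by
      simpa using (hxl.pow 2).const_sub 1
    refine squeeze_zero (fun t => (nB_pos _ hκ).le) (fun t => ?_) h1
    rw [nB]
    have := Real.tanh_sq_lt_one (γ t).2.2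
    exact mul_le_of_le_one_left (by linarith) (wB_le_one _ hκ)
  have he : Tendsto (fun t => √(1 + 4 * Real.exp (γ t).1 ^ 2)) atBot (𝓝 1) := by
    have h1 : Tendsto (fun t => 1 + 4 * Real.exp (γ t).1 ^ 2) atBot (𝓝 1) := by
      simpa using (((Real.tendsto_exp_atBot.comp hv).pow 2).const_mul 4).const_add 1
    simpa using h1.sqrt
  have hb1 : Tendsto (fun t => 1 - nB κ (γ t)) atBot (𝓝 1) := by simpa using hb.const_sub 1
  simp only [toY_toState _ hκ]
  refine Tendsto.prodMk_nhds ?_ (Tendsto.prodMk_nhds ?_ ?_)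
  · simpa using (hb.div (hb1.const_mul 2) (by norm_num)).mul he
  · have := (Real.continuous_arccos.tendsto _).comp (he.inv₀ one_ne_zero).neg
    simpa [Function.comp_def] using this
  · simpa [Pi.div_def] using hxl.div hb1.sqrt (by simp)

/-- In vacuum every orbit has negative shear at some time in the past: `sinh χ √(1 + 4 e⁻ᵛ)`, which is
`sinh (artanh Σ₊)`, has a derivative of at least `2 / 3`. -/
theorem exists_χ_neg_of_vacuum (hγ : ∀ t, HasDerivAt γ (field 0 s (γ t)) t) :
    ∃ t, (γ t).2.2 < 0 := by
  set E : ℝ → ℝ := fun t => 4 * Real.exp (-(γ t).1) with hE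
  have hE0 : ∀ t, 0 < E t := fun t => by positivity
  have hdE : ∀ t, HasDerivAt E (E t * (6 * Real.tanh (γ t).2.2)) t := fun t => by
    refine ((hasDerivAt_v hγ t).fun_neg.exp.const_mul 4).congr_deriv ?_
    simp only [hE]
    ring
  have hdS : ∀ t, HasDerivAt (fun t => Real.sinh (γ t).2.2 * √(1 + E t))
      (Real.cosh (γ t).2.2 * accel 0 s (γ t) * √(1 + E t) +
        Real.sinh (γ t).2.2 * (E t * (6 * Real.tanh (γ t).2.2) / (2 * √(1 + E t)))) t := fun t =>
    (hasDerivAt_χ hγ t).sinh.fun_mul (((hdE t).const_add 1).sqrt (by linarith [hE0 t]))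
  have hbound : ∀ t, 2 / 3 ≤ Real.cosh (γ t).2.2 * accel 0 s (γ t) * √(1 + E t) +
        Real.sinh (γ t).2.2 * (E t * (6 * Real.tanh (γ t).2.2) / (2 * √(1 + E t))) := by
    intro t
    have hr0 : 0 < 1 + E t := by linarith [hE0 t]
    have hr : 0 < √(1 + E t) := Real.sqrt_pos.2 hr0
    have hr1 : 1 ≤ √(1 + E t) := by
      rw [Real.one_le_sqrt]
      linarith [hE0 t]
    have hr2 : √(1 + E t) ^ 2 = 1 + E t := Real.sq_sqrt hr0.le
    have hc1 := Real.one_le_cosh (γ t).2.2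
    have hsinh : Real.sinh (γ t).2.2 = Real.cosh (γ t).2.2 * Real.tanh (γ t).2.2 := by
      rw [Real.tanh_eq_sinh_div_cosh]
      field_simp
    have hx := abs_lt.1 (Real.abs_tanh_lt_one (γ t).2.2)
    have hacc : (1 + E t) * accel 0 s (γ t) =
        -2 * Real.tanh (γ t).2.2 * (1 + E t) + 4 + E t := by
      have he := Real.exp_pos (γ t).1
      simp only [accel, wF, wM, wB, potential, hE, Real.exp_neg]
      field_simp
      ring
    generalize Real.tanh (γ t).2.2 = x at *
    generalize Real.cosh (γ t).2.2 = C at *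
    rw [hsinh]
    have e : C * accel 0 s (γ t) * √(1 + E t) + C * x * (E t * (6 * x) / (2 * √(1 + E t))) =
        C / √(1 + E t) * (4 - 2 * x + E t * (1 - 2 * x + 3 * x ^ 2)) := by
      field_simp
      rw [hr2]
      linear_combination 2 * hacc
    have h2 : 2 / 3 * (1 + E t) ≤ 4 - 2 * x + E t * (1 - 2 * x + 3 * x ^ 2) := by
      nlinarith [mul_nonneg (hE0 t).le (sq_nonneg (3 * x - 1)), hE0 t]
    rw [e]
    calc (2 / 3 : ℝ) ≤ 1 * √(1 + E t) * (2 / 3) := by linarith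
      _ ≤ C * √(1 + E t) * (2 / 3) := by gcongr
      _ = C / √(1 + E t) * (2 / 3 * (1 + E t)) := by
          field_simp
          rw [hr2]
      _ ≤ _ := by gcongr
  have := tendsto_atBot_of_le_deriv (t₀ := 0) (by norm_num : (0 : ℝ) < 2 / 3) hdS fun t _ => hbound t
  obtain ⟨t, ht⟩ := (this.eventually_lt_atBot 0).exists
  refine ⟨t, Real.sinh_neg_iff.1 ?_⟩
  by_contra h
  exact absurd ht (not_lt.2 (mul_nonneg (not_lt.1 h) (Real.sqrt_nonneg _)))

/-! ### The future -/

theorem decel_mem (hκ : 0 ≤ κ) (hs0 : 0 < s) (hs4 : s < 4) (p : ℝ × ℝ × ℝ) :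
    0 ≤ decel κ s p ∧ decel κ s p ≤ 2 := by
  have h1 := nM_pos p hκ
  have h2 := nB_pos p hκ
  have h3 := nF_nonneg p hκ
  have h4 := n_sum p hκ
  unfold decel
  constructor
  · positivity
  · nlinarith

/-- If a quantity that is bounded from above grows along the orbit as long as the shear differs from
`x∞` or the curvature variable `nM` does not vanish, then the orbit converges, and the limit is
determined by the equilibrium condition. -/
theorem tendsto_of_monotone (hκ : 0 ≤ κ) (hs0 : 0 < s) (hs4 : s < 4)
    (hγ : ∀ t, HasDerivAt γ (field κ s (γ t)) t) {P P' : ℝ → ℝ} {k C x : ℝ} (hk : 0 < k)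
    (hP : ∀ t, HasDerivAt P (P' t) t) (hC : ∀ t, P t ≤ C)
    (h1 : ∀ t, k * (Real.tanh (γ t).2.2 - x) ^ 2 ≤ P' t) (h2 : ∀ t, k * nM κ (γ t) ≤ P' t)
    (hx : |x| ≤ 1) (hsx : 1 - s / 2 * x ≠ 0) :
    Tendsto (fun t => Real.tanh (γ t).2.2) atTop (𝓝 x) ∧
    Tendsto (fun t => nM κ (γ t)) atTop (𝓝 0) ∧
    Tendsto (fun t => nB κ (γ t)) atTop
      (𝓝 (x * (1 - x ^ 2) * (2 - s / 2) / (1 - s / 2 * x))) := by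
  obtain ⟨L, hL⟩ := exists_tendsto_of_deriv_nonneg_of_le hP
    (fun t => (mul_nonneg hk.le (nM_pos _ hκ).le).trans (h2 t)) hC
  have bx : ∀ t, |Real.tanh (γ t).2.2| ≤ 1 := fun t => (Real.abs_tanh_lt_one _).le
  have bM : ∀ t, |nM κ (γ t)| ≤ 1 := fun t => by
    rw [abs_of_pos (nM_pos _ hκ)]
    linarith [n_sum (γ t) hκ, nB_pos (γ t) hκ, nF_nonneg (γ t) hκ, sq_nonneg (Real.tanh (γ t).2.2)]
  have bB : ∀ t, |nB κ (γ t)| ≤ 1 := fun t => by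
    rw [abs_of_pos (nB_pos _ hκ)]
    exact (nB_lt_one _ hκ).le
  have bF : ∀ t, |nF κ (γ t)| ≤ 1 := fun t => by
    rw [abs_of_nonneg (nF_nonneg _ hκ)]
    linarith [n_sum (γ t) hκ, nB_pos (γ t) hκ, nM_pos (γ t) hκ, sq_nonneg (Real.tanh (γ t).2.2)]
  have bq : ∀ t, |2 - decel κ s (γ t)| ≤ 2 := fun t => by
    have := decel_mem hκ hs0 hs4 (γ t)
    rw [abs_le]; constructor <;> linarith
  have key : ∀ {a y b c : ℝ}, |a| ≤ b → |y| ≤ c → |a * y| ≤ b * c := fun h1 h2 => by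
    rw [abs_mul]
    exact mul_le_mul h1 h2 (abs_nonneg _) ((abs_nonneg _).trans h1)
  set x' : ℝ → ℝ := fun t =>
    -(2 - decel κ s (γ t)) * Real.tanh (γ t).2.2 + 4 * nM κ (γ t) + nB κ (γ t) with hx'
  have dx : ∀ t, HasDerivAt (fun t => Real.tanh (γ t).2.2) (x' t) t := hasDerivAt_x hγ
  have bx' : ∀ t, |x' t| ≤ 7 := fun t => by
    have e1 := key (by rw [abs_neg]; exact bq t : |-(2 - decel κ s (γ t))| ≤ 2) (bx t)
    have e2 := key (by norm_num : |(4 : ℝ)| ≤ 4) (bM t)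
    exact (abs_add_three _ _ _).trans (by linarith [bB t])
  have bq8 : ∀ t, |2 * decel κ s (γ t) - 8 * Real.tanh (γ t).2.2| ≤ 12 := fun t => by
    have := decel_mem hκ hs0 hs4 (γ t)
    have := abs_le.1 (bx t)
    rw [abs_le]; constructor <;> linarith
  have bq2 : ∀ t, |2 * decel κ s (γ t) - 2 * Real.tanh (γ t).2.2| ≤ 6 := fun t => by
    have := decel_mem hκ hs0 hs4 (γ t)
    have := abs_le.1 (bx t)
    rw [abs_le]; constructor <;> linarith
  have bqs : ∀ t, |2 * decel κ s (γ t) - s| ≤ 8 := fun t => by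
    have := decel_mem hκ hs0 hs4 (γ t)
    rw [abs_le]; constructor <;> linarith
  have dM := hasDerivAt_nM hκ hγ
  have dB := hasDerivAt_nB hκ hγ
  have dF := hasDerivAt_nF hκ hγ
  have bM' : ∀ t, _ := fun t => key (bM t) (bq8 t)
  have bB' : ∀ t, _ := fun t => key (bB t) (bq2 t)
  have bF' : ∀ t, _ := fun t => key (bF t) (bqs t)
  have hM0 : Tendsto (fun t => nM κ (γ t)) atTop (𝓝 0) := by
    rw [Metric.tendsto_nhds]
    intro ε hε
    filter_upwards [eventually_lt_of_tendsto_of_le_deriv (K := k * (1 * 12)) hP h2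
      (abs_sub_le_of_abs_deriv_le (fun t => (dM t).const_mul k) fun t => by
        rw [abs_mul, abs_of_pos hk]; gcongr; exact bM' t) hL (mul_pos hk hε)] with t ht
    rw [Real.dist_eq, sub_zero, abs_of_pos (nM_pos _ hκ)]
    exact lt_of_mul_lt_mul_left ht hk.le
  have hx0 : Tendsto (fun t => Real.tanh (γ t).2.2) atTop (𝓝 x) := by
    rw [Metric.tendsto_nhds]
    intro ε hε
    filter_upwards [eventually_lt_of_tendsto_of_le_deriv (K := k * (4 * 7)) hP h1
      (abs_sub_le_of_abs_deriv_le (fun t => (((dx t).sub_const x).fun_pow 2).const_mul k) fun t => by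
        have e1 : |2 * (Real.tanh (γ t).2.2 - x)| ≤ 4 := by
          have := abs_le.1 (bx t)
          have := abs_le.1 hx
          rw [abs_le]; constructor <;> linarith
        have := key e1 (bx' t)
        rw [abs_mul, abs_of_pos hk]
        gcongr
        simpa using this) hL (mul_pos hk (pow_pos hε 2))] with t ht
    rw [Real.dist_eq]
    exact abs_lt_of_sq_lt_sq (lt_of_mul_lt_mul_left ht hk.le) hε.le
  have hx'0 : Tendsto x' atTop (𝓝 0) := by
    have dq : ∀ t, HasDerivAt (fun t => decel κ s (γ t)) (4 * (Real.tanh (γ t).2.2 * x' t) +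
        s / 2 * (nF κ (γ t) * (2 * decel κ s (γ t) - s))) t := fun t => by
      refine ((((dx t).fun_pow 2).const_mul 2).fun_add ((dF t).const_mul (s / 2))).congr_deriv ?_
      simp
      ring
    have bq' : ∀ t, |4 * (Real.tanh (γ t).2.2 * x' t) +
        s / 2 * (nF κ (γ t) * (2 * decel κ s (γ t) - s))| ≤ 4 * (1 * 7) + 2 * (1 * 8) := fun t => by
      have e1 := key (by norm_num : |(4 : ℝ)| ≤ 4) (key (bx t) (bx' t))
      have e2 := key (by rw [abs_of_pos (by positivity)]; linarith : |s / 2| ≤ 2) (bF' t)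
      exact (abs_add_le _ _).trans (by linarith)
    refine tendsto_zero_of_tendsto_of_lipschitz_deriv (K := 200) dx
      (abs_sub_le_of_abs_deriv_le (fun t => ((((dq t).const_sub 2).fun_neg.fun_mul (dx t)).fun_add
        ((dM t).const_mul 4)).fun_add (dB t)) fun t => ?_) hx0
    have e1 := key (bq' t) (bx t)
    have e2 := key (by rw [abs_neg]; exact bq t : |-(2 - decel κ s (γ t))| ≤ 2) (bx' t)
    have e3 := key (by norm_num : |(4 : ℝ)| ≤ 4) (bM' t)
    rw [neg_neg]
    refine (abs_add_three _ _ _).trans ?_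
    have e4 := (abs_add_le _ _).trans (add_le_add e1 e2)
    linarith [bB' t]
  refine ⟨hx0, hM0, ?_⟩
  -- The equation for the shear is solved for `nB`.
  have hlim : Tendsto (fun t => (x' t + (2 - 2 * Real.tanh (γ t).2.2 ^ 2
      - s / 2 * (1 - Real.tanh (γ t).2.2 ^ 2 - nM κ (γ t))) * Real.tanh (γ t).2.2
      - 4 * nM κ (γ t)) / (1 - s / 2 * Real.tanh (γ t).2.2)) atTop
      (𝓝 ((0 + (2 - 2 * x ^ 2 - s / 2 * (1 - x ^ 2 - 0)) * x - 4 * 0) / (1 - s / 2 * x))) := by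
    refine Tendsto.div ?_ ((hx0.const_mul _).const_sub 1) hsx
    refine ((hx'0.add (Tendsto.mul ?_ hx0)).sub (hM0.const_mul 4))
    exact (((hx0.pow 2).const_mul 2).const_sub 2).sub
      ((((hx0.pow 2).const_sub 1).sub hM0).const_mul _)
  have e : (0 + (2 - 2 * x ^ 2 - s / 2 * (1 - x ^ 2 - 0)) * x - 4 * 0) / (1 - s / 2 * x) =
      x * (1 - x ^ 2) * (2 - s / 2) / (1 - s / 2 * x) := by ring
  rw [e] at hlim
  refine hlim.congr' ?_
  filter_upwards [((hx0.const_mul (s / 2)).const_sub 1).eventually_ne hsx] with t ht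
  rw [div_eq_iff ht, hx']
  simp only [decel]
  linear_combination (s / 2 * Real.tanh (γ t).2.2) * n_sum (γ t) hκ

theorem continuousAt_toY {y : ℝ × ℝ × ℝ} (hy : 1 < y.1) : ContinuousAt toY y := by
  have hr : ContinuousAt coordR y := by
    unfold coordR
    fun_prop
  have hr0 : 2 * coordR y ≠ 0 := by linarith [(toY_spec y hy).1]
  have hθ : ContinuousAt coordTheta y :=
    Real.continuous_arccos.continuousAt.comp (ContinuousAt.div (by fun_prop) (by fun_prop) hr0)
  exact hr.prodMk (hθ.prodMk (by fun_prop))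

theorem tendsto_toY_of_tendsto {x b : ℝ} (hb0 : 0 < b) (hb1 : b < 1)
    (hx : Tendsto (fun t => Real.tanh (γ t).2.2) atTop (𝓝 x))
    (hM : Tendsto (fun t => nM κ (γ t)) atTop (𝓝 0))
    (hB : Tendsto (fun t => nB κ (γ t)) atTop (𝓝 b)) :
    Tendsto (fun t => toY (toState κ (γ t))) atTop (𝓝 (toY (1 / √(1 - b), x / √(1 - b), 0))) := by
  have h1 : 0 < √(1 - b) := Real.sqrt_pos.2 (by linarith)
  have hs : Tendsto (fun t => √(1 - nB κ (γ t))) atTop (𝓝 √(1 - b)) := (hB.const_sub 1).sqrt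
  refine (continuousAt_toY ?_).tendsto.comp (Tendsto.prodMk_nhds ?_ (Tendsto.prodMk_nhds ?_ ?_))
  · rw [lt_div_iff₀ h1, one_mul]
    exact (Real.sqrt_lt' one_pos).2 (by linarith)
  · exact tendsto_const_nhds.div hs h1.ne'
  · exact hx.div hs h1.ne'
  · simpa [Pi.div_def] using (hM.const_mul 12).sqrt.div hs h1.ne'

/-- In vacuum and for `w ≥ 0` the function `1 / (g₂₂ (2 H - σ₊)²)` is monotone. -/
theorem tendsto_pointD (hκ : 0 ≤ κ) (hs0 : 0 < s) (hs4 : s < 4)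
    (hγ : ∀ t, HasDerivAt γ (field κ s (γ t)) t) (hκs : κ = 0 ∨ 1 ≤ s) :
    Tendsto (fun t => toY (toState κ (γ t))) atTop (𝓝 pointD) := by
  have hF : ∀ t, 0 ≤ (s - 1) * nF κ (γ t) := fun t => by
    rcases hκs with h | h
    · simp [nF, wF, h]
    · exact mul_nonneg (by linarith) (nF_nonneg _ hκ)
  have hx : ∀ t, 0 < 2 - Real.tanh (γ t).2.2 ∧ 2 - Real.tanh (γ t).2.2 ≤ 3 ∧
      1 ≤ 2 - Real.tanh (γ t).2.2 := fun t => by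
    have := abs_lt.1 (Real.abs_tanh_lt_one (γ t).2.2)
    refine ⟨?_, ?_, ?_⟩ <;> linarith
  have hd : ∀ t, HasDerivAt
      (fun t => Real.log (nB κ (γ t)) - 2 * Real.log (2 - Real.tanh (γ t).2.2))
      ((2 * (1 - 2 * Real.tanh (γ t).2.2) ^ 2 + 2 * ((s - 1) * nF κ (γ t)) + 6 * nM κ (γ t)) /
        (2 - Real.tanh (γ t).2.2)) t := fun t => by
    have hb := (nB_pos (γ t) hκ).ne'
    have hx0 := (hx t).1.ne'
    refine (((hasDerivAt_nB hκ hγ t).log hb).fun_sub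
      ((((hasDerivAt_x hγ t).const_sub 2).log hx0).const_mul 2)).congr_deriv ?_
    field_simp
    simp only [decel]
    linear_combination 2 * n_sum (γ t) hκ
  obtain ⟨l1, l2, l3⟩ := tendsto_of_monotone hκ hs0 hs4 hγ (k := 2) (C := 0) (x := 1 / 2)
    (by norm_num) hd (fun t => by
      have h1 := Real.log_nonpos (nB_pos (γ t) hκ).le (nB_lt_one (γ t) hκ).le
      have h2 := Real.log_nonneg (hx t).2.2
      linarith)
    (fun t => by
      rw [le_div_iff₀ (hx t).1]
      have := mul_le_mul_of_nonneg_left (hx t).2.1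
        (by positivity : 0 ≤ 2 * (Real.tanh (γ t).2.2 - 1 / 2) ^ 2)
      nlinarith [hF t, nM_pos (γ t) hκ, sq_nonneg (1 - 2 * Real.tanh (γ t).2.2)])
    (fun t => by
      rw [le_div_iff₀ (hx t).1]
      have := mul_le_mul_of_nonneg_left (hx t).2.1 (by linarith [nM_pos (γ t) hκ] :
        0 ≤ 2 * nM κ (γ t))
      nlinarith [hF t, sq_nonneg (1 - 2 * Real.tanh (γ t).2.2)])
    (by rw [abs_le]; constructor <;> norm_num) (by linarith)
  have hb : (1 / 2 : ℝ) * (1 - (1 / 2) ^ 2) * (2 - s / 2) / (1 - s / 2 * (1 / 2)) = 3 / 4 := by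
    rw [div_eq_iff (by linarith)]
    ring
  rw [hb] at l3
  have := tendsto_toY_of_tendsto (by norm_num) (by norm_num) l1 l2 l3
  have h4 : √(1 - 3 / 4 : ℝ) = 1 / 2 := by
    rw [Real.sqrt_eq_iff_mul_self_eq (by norm_num) (by norm_num)]
    norm_num
  rw [h4] at this
  convert this using 2
  rw [pointD]
  norm_num

/-- For fluids with `w < 0` a product of powers of `1 / g₂₂`, `ρ` and `2 H - (1 + 3 w) σ₊` is
monotone. The exponents are those for which the derivative of its logarithm is a combination of a
square and `nM` with positive coefficients. -/
theorem tendsto_pointP (hκ : 0 < κ) (hs0 : 0 < s) (hs1 : s < 1)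
    (hγ : ∀ t, HasDerivAt γ (field κ s (γ t)) t) :
    Tendsto (fun t => toY (toState κ (γ t))) atTop (𝓝 (toY (2 / (2 - s), s / (2 - s), 0))) := by
  have hs2 : 0 < 4 - s ^ 2 := by nlinarith
  set e : ℝ := (4 - s) / (4 - s ^ 2) with he
  have hee : e * (4 - s ^ 2) = 4 - s := by rw [he]; field_simp
  have he34 : 3 / 4 ≤ e := by
    rw [he, le_div_iff₀ hs2]
    nlinarith
  have hse : s * e ≤ 1 := by
    rw [he, mul_div_assoc', div_le_one hs2]
    nlinarith
  clear_value e
  have hF : ∀ t, 0 < nF κ (γ t) := fun t => by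
    refine mul_pos (div_pos (by positivity) (potential_pos _ hκ.le)) ?_
    linarith [Real.tanh_sq_lt_one (γ t).2.2]
  have hF1 : ∀ t, nF κ (γ t) ≤ 1 := fun t => by
    linarith [n_sum (γ t) hκ.le, nB_pos (γ t) hκ.le, nM_pos (γ t) hκ.le,
      sq_nonneg (Real.tanh (γ t).2.2)]
  have hx : ∀ t, 0 < 2 - s * Real.tanh (γ t).2.2 ∧ 2 - s * Real.tanh (γ t).2.2 ≤ 3 ∧
      1 ≤ 2 - s * Real.tanh (γ t).2.2 := fun t => by
    have := abs_lt.1 (Real.abs_tanh_lt_one (γ t).2.2)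
    refine ⟨?_, ?_, ?_⟩ <;> nlinarith
  have hd : ∀ t, HasDerivAt
      (fun t => s * e * Real.log (nB κ (γ t)) + (1 - s * e) * Real.log (nF κ (γ t))
        - 2 * Real.log (2 - s * Real.tanh (γ t).2.2))
      ((2 * e * (s - 2 * Real.tanh (γ t).2.2) ^ 2 + 6 * s * nM κ (γ t)) /
        (2 - s * Real.tanh (γ t).2.2)) t := fun t => by
    have hb := (nB_pos (γ t) hκ.le).ne'
    have hf := (hF t).ne'
    have hx0 := (hx t).1.ne'
    refine (((((hasDerivAt_nB hκ.le hγ t).log hb).const_mul (s * e)).fun_add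
      (((hasDerivAt_nF hκ.le hγ t).log hf).const_mul (1 - s * e))).fun_sub
      (((((hasDerivAt_x hγ t).const_mul s).const_sub 2).log hx0).const_mul 2)).congr_deriv ?_
    field_simp
    simp only [decel]
    linear_combination 2 * s * n_sum (γ t) hκ.le +
      Real.tanh (γ t).2.2 * (s - 2 * Real.tanh (γ t).2.2) * hee
  obtain ⟨l1, l2, l3⟩ := tendsto_of_monotone hκ.le hs0 (by linarith) hγ (k := 2 * s) (C := 0)
    (x := s / 2) (by linarith) hd (fun t => by
      have h1 := Real.log_nonpos (nB_pos (γ t) hκ.le).le (nB_lt_one (γ t) hκ.le).le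
      have h2 := Real.log_nonneg (hx t).2.2
      have h3 := Real.log_nonpos (hF t).le (hF1 t)
      have h4 : 0 ≤ s * e := by positivity
      nlinarith)
    (fun t => by
      rw [le_div_iff₀ (hx t).1]
      have hsq := sq_nonneg (s - 2 * Real.tanh (γ t).2.2)
      have h1 := mul_le_mul_of_nonneg_left (hx t).2.1
        (by positivity : 0 ≤ 2 * s * (Real.tanh (γ t).2.2 - s / 2) ^ 2)
      have h2 : 2 * (3 / 4) * (s - 2 * Real.tanh (γ t).2.2) ^ 2 ≤
          2 * e * (s - 2 * Real.tanh (γ t).2.2) ^ 2 := by gcongr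
      have h3 := mul_nonneg (by linarith : 0 ≤ 1 - s) hsq
      nlinarith [mul_pos hs0 (nM_pos (γ t) hκ.le)])
    (fun t => by
      rw [le_div_iff₀ (hx t).1]
      have h0 := mul_pos hs0 (nM_pos (γ t) hκ.le)
      have h1 := mul_le_mul_of_nonneg_left (hx t).2.1 (by linarith : 0 ≤ 2 * (s * nM κ (γ t)))
      have h2 : 0 ≤ 2 * e * (s - 2 * Real.tanh (γ t).2.2) ^ 2 := by positivity
      linarith)
    (by rw [abs_le]; constructor <;> linarith) (by nlinarith)
  have hb : s / 2 * (1 - (s / 2) ^ 2) * (2 - s / 2) / (1 - s / 2 * (s / 2)) = s * (4 - s) / 4 := by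
    rw [div_eq_iff (by nlinarith)]
    ring
  rw [hb] at l3
  have := tendsto_toY_of_tendsto (by nlinarith) (by nlinarith) l1 l2 l3
  have h4 : √(1 - s * (4 - s) / 4) = (2 - s) / 2 := by
    rw [Real.sqrt_eq_iff_mul_self_eq (by nlinarith) (by linarith)]
    ring
  rw [h4] at this
  have h5 : 2 - s ≠ 0 := by linarith
  have e1 : 1 / ((2 - s) / 2) = 2 / (2 - s) := by field_simp
  have e2 : s / 2 / ((2 - s) / 2) = s / (2 - s) := by field_simp
  rwa [e1, e2] at this

end Reduced

/-! ### The reduced variables of a solution -/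

namespace LRSModel

open Reduced

variable {S : LRSModel} {I : Set ℝ}

/-- An expanding solution with `p = w ρ` and `ρ = κ R`, where the positive function `R` is diluted like
the energy density of the fluid. A fluid has `κ = 1` and `R = ρ`; the choice `κ = 0` describes vacuum,
with `R` a dummy variable. -/
structure IsExpanding (S : LRSModel) (I : Set ℝ) (w κ : ℝ) (R : ℝ → ℝ) : Prop where
  isSolution : S.IsSolution I
  hubble_pos : ∀ t ∈ I, 0 < S.hubble t
  p_eq : ∀ t ∈ I, S.p t = w * S.ρ t
  ρ_eq : ∀ t ∈ I, S.ρ t = κ * R t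
  R_pos : ∀ t ∈ I, 0 < R t
  deriv_R : ∀ t ∈ I, HasDerivAt R (-(3 * (1 + w)) * S.hubble t * R t) t

/-- The logarithmic time `τ`, normalised by `det g = e ^ (6 τ)`. -/
noncomputable def logTime (S : LRSModel) (t : ℝ) : ℝ :=
  (Real.log (S.g₁₁ t) + 2 * Real.log (S.g₂₂ t)) / 6

/-- The unconstrained variables `(v, ζ, χ)`. -/
noncomputable def coords (S : LRSModel) (R : ℝ → ℝ) (t : ℝ) : ℝ × ℝ × ℝ :=
  (Real.log (S.g₁₁ t) - Real.log (S.g₂₂ t), Real.log (R t) + Real.log (S.g₂₂ t),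
    (Real.log (S.hubble t + S.shear t) - Real.log (S.hubble t - S.shear t)) / 2)

theorem k₁_eq (t : ℝ) : S.k₁ t = -S.hubble t + 2 * S.shear t := by
  rw [hubble, shear]; ring

theorem k₂_eq (t : ℝ) : S.k₂ t = -S.hubble t - S.shear t := by
  rw [hubble, shear]; ring

theorem trK_eq (t : ℝ) : S.trK t = -3 * S.hubble t := by
  rw [hubble, trK]; ring

theorem m₁_sq {t : ℝ} (h : 0 ≤ S.g₁₁ t) : S.m₁ t ^ 2 = S.g₁₁ t / S.g₂₂ t ^ 2 := by
  rw [m₁, div_pow, Real.sq_sqrt h]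

theorem ric₁_eq {t : ℝ} (h : 0 ≤ S.g₁₁ t) : S.ric₁ t = S.g₁₁ t / S.g₂₂ t ^ 2 / 2 := by
  rw [ric₁, ricciClassA, n₁, neg_sq, m₁_sq h]
  ring

theorem ric₂_eq {t : ℝ} (h1 : 0 < S.g₁₁ t) :
    S.ric₂ t = -(1 / S.g₂₂ t) - S.g₁₁ t / S.g₂₂ t ^ 2 / 2 := by
  have h := Real.sqrt_pos.2 h1
  have h2 : S.n₂ t * S.m₁ t = 1 / S.g₂₂ t := by
    rw [n₂, m₁]
    field_simp
  rw [ric₂, ricciClassA, n₁, ← h2, ← m₁_sq h1.le]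
  ring

/-- The Hamiltonian constraint in terms of the Hubble scalar and the shear. -/
theorem IsSolution.constraint (hS : S.IsSolution I) {t : ℝ} (ht : t ∈ I) :
    3 * (S.hubble t ^ 2 - S.shear t ^ 2) =
      S.g₁₁ t / S.g₂₂ t ^ 2 / 4 + 1 / S.g₂₂ t + S.ρ t := by
  have h := hS.hamiltonian t ht
  have h1 := hS.g₁₁_pos t ht
  rw [ric₁_eq h1.le, ric₂_eq h1, trK_eq, k₁_eq, k₂_eq] at h
  linear_combination h / 2

theorem IsSolution.hasDerivAt_hubble (hS : S.IsSolution I) {t : ℝ} (ht : t ∈ I) :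
    HasDerivAt S.hubble
      (-S.hubble t ^ 2 - 2 * S.shear t ^ 2 - (S.ρ t + 3 * S.p t) / 6) t := by
  have h1 := hS.g₁₁_pos t ht
  refine (((hS.deriv_k₁ t ht).fun_add
    ((hS.deriv_k₂ t ht).const_mul 2)).fun_neg.div_const 3).congr_deriv ?_
  rw [ric₁_eq h1.le, ric₂_eq h1, trK_eq, k₁_eq, k₂_eq]
  linear_combination (-2 / 3) * hS.constraint ht

theorem IsSolution.hasDerivAt_shear (hS : S.IsSolution I) {t : ℝ} (ht : t ∈ I) :
    HasDerivAt S.shear (-3 * S.hubble t * S.shear t +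
      (S.g₁₁ t / S.g₂₂ t ^ 2 + 1 / S.g₂₂ t) / 3) t := by
  have h1 := hS.g₁₁_pos t ht
  refine (((hS.deriv_k₁ t ht).fun_sub (hS.deriv_k₂ t ht)).div_const 3).congr_deriv ?_
  rw [ric₁_eq h1.le, ric₂_eq h1, trK_eq, k₁_eq, k₂_eq]
  ring

theorem IsSolution.hasDerivAt_log_g₁₁ (hS : S.IsSolution I) {t : ℝ} (ht : t ∈ I) :
    HasDerivAt (fun t => Real.log (S.g₁₁ t)) (2 * S.hubble t - 4 * S.shear t) t := by
  have h1 := (hS.g₁₁_pos t ht).ne'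
  refine ((hS.deriv_g₁₁ t ht).log h1).congr_deriv ?_
  rw [k₁_eq]
  field_simp
  ring

theorem IsSolution.hasDerivAt_log_g₂₂ (hS : S.IsSolution I) {t : ℝ} (ht : t ∈ I) :
    HasDerivAt (fun t => Real.log (S.g₂₂ t)) (2 * S.hubble t + 2 * S.shear t) t := by
  have h1 := (hS.g₂₂_pos t ht).ne'
  refine ((hS.deriv_g₂₂ t ht).log h1).congr_deriv ?_
  rw [k₂_eq]
  field_simp
  ring

theorem IsSolution.hasDerivAt_logTime (hS : S.IsSolution I) {t : ℝ} (ht : t ∈ I) :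
    HasDerivAt S.logTime (S.hubble t) t := by
  refine (((hS.hasDerivAt_log_g₁₁ ht).fun_add
    ((hS.hasDerivAt_log_g₂₂ ht).const_mul 2)).div_const 6).congr_deriv ?_
  ring

theorem IsVacuum.isExpanding (hS : S.IsVacuum I) (hH : ∀ t ∈ I, 0 < S.hubble t) :
    S.IsExpanding I 0 0 fun t => Real.exp (-3 * S.logTime t) where
  isSolution := hS.1
  hubble_pos := hH
  p_eq t ht := by rw [(hS.2 t ht).2, zero_mul]
  ρ_eq t ht := by rw [(hS.2 t ht).1, zero_mul]
  R_pos t ht := Real.exp_pos _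
  deriv_R t ht := by
    refine ((hS.1.hasDerivAt_logTime ht).const_mul (-3)).exp.congr_deriv ?_
    ring

/-- The energy density is diluted according to the conservation of energy, as a consequence of the
Einstein equations. -/
theorem IsLinearFluid.isExpanding {w : ℝ} (hS : IsLinearFluid w S I)
    (hH : ∀ t ∈ I, 0 < S.hubble t) : S.IsExpanding I w 1 S.ρ where
  isSolution := hS.1
  hubble_pos := hH
  p_eq t ht := (hS.2 t ht).2
  ρ_eq t ht := (one_mul _).symm
  R_pos t ht := (hS.2 t ht).1
  deriv_R t ht := by
    have h1 := (hS.1.g₁₁_pos t ht).ne'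
    have h2 := (hS.1.g₂₂_pos t ht).ne'
    have hd := (((hS.1.hasDerivAt_hubble ht).fun_pow 2).fun_sub
      ((hS.1.hasDerivAt_shear ht).fun_pow 2)).const_mul 3
    have hm := (((hS.1.deriv_g₁₁ t ht).fun_div ((hS.1.deriv_g₂₂ t ht).fun_pow 2)
      (pow_ne_zero 2 h2)).div_const 4).fun_add ((hS.1.deriv_g₂₂ t ht).fun_inv h2)
    refine ((hd.fun_sub hm).congr_of_eventuallyEq ?_).congr_deriv ?_
    · filter_upwards [hS.1.isOpen.mem_nhds ht] with u hu
      have := hS.1.constraint hu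
      rw [this]
      ring
    · have hc := hS.1.constraint ht
      rw [(hS.2 t ht).2, k₁_eq, k₂_eq]
      have e : S.g₁₁ t / S.g₂₂ t ^ 2 = 4 * (3 * (S.hubble t ^ 2 - S.shear t ^ 2) -
        1 / S.g₂₂ t - S.ρ t) := by linear_combination (-4) * hc
      have e' : S.g₁₁ t = 4 * (3 * (S.hubble t ^ 2 - S.shear t ^ 2) -
        1 / S.g₂₂ t - S.ρ t) * S.g₂₂ t ^ 2 := by
        rw [← e]; field_simp
      rw [e']
      field_simp
      ring

namespace IsExpanding

variable {w κ : ℝ} {R : ℝ → ℝ}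

theorem abs_shear_lt (h : S.IsExpanding I w κ R) (hκ : 0 ≤ κ) {t : ℝ} (ht : t ∈ I) :
    |S.shear t| < S.hubble t := by
  have h1 := h.isSolution.g₁₁_pos t ht
  have h2 := h.isSolution.g₂₂_pos t ht
  have h3 := h.R_pos t ht
  have hc := h.isSolution.constraint ht
  rw [h.ρ_eq t ht] at hc
  refine abs_lt_of_sq_lt_sq ?_ (h.hubble_pos t ht).le
  have : 0 < S.g₁₁ t / S.g₂₂ t ^ 2 / 4 + 1 / S.g₂₂ t + κ * R t := by positivity
  linarith

theorem tanh_coords (h : S.IsExpanding I w κ R) (hκ : 0 ≤ κ) {t : ℝ} (ht : t ∈ I) :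
    Real.tanh (S.coords R t).2.2 = S.shear t / S.hubble t := by
  have hs := abs_lt.1 (h.abs_shear_lt hκ ht)
  have hp : 0 < S.hubble t + S.shear t := by linarith
  have hm : 0 < S.hubble t - S.shear t := by linarith
  have hH := h.hubble_pos t ht
  set A := Real.exp (S.coords R t).2.2 with hA
  have hA0 : 0 < A := Real.exp_pos _
  have hA2 : A ^ 2 * (S.hubble t - S.shear t) = S.hubble t + S.shear t := by
    rw [hA, ← Real.exp_nat_mul, coords]
    simp only [Nat.cast_ofNat]
    rw [mul_div_cancel₀ _ (two_ne_zero), Real.exp_sub, Real.exp_log hp, Real.exp_log hm]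
    field_simp
  rw [Real.tanh_eq, Real.exp_neg, ← hA]
  field_simp
  linear_combination hA2

theorem exp_v (h : S.IsExpanding I w κ R) {t : ℝ} (ht : t ∈ I) :
    Real.exp (S.coords R t).1 = S.g₁₁ t / S.g₂₂ t := by
  rw [coords, Real.exp_sub, Real.exp_log (h.isSolution.g₁₁_pos t ht),
    Real.exp_log (h.isSolution.g₂₂_pos t ht)]

theorem potential_coords (h : S.IsExpanding I w κ R) {t : ℝ} (ht : t ∈ I) :
    potential κ (S.coords R t) =
      3 * (S.hubble t ^ 2 - S.shear t ^ 2) * S.g₂₂ t := by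
  have h2 := h.isSolution.g₂₂_pos t ht
  have e : Real.exp (S.coords R t).2.1 = R t * S.g₂₂ t := by
    rw [coords, Real.exp_add, Real.exp_log (h.R_pos t ht), Real.exp_log h2]
  rw [potential, h.exp_v ht, e, h.isSolution.constraint ht, h.ρ_eq t ht]
  field_simp

theorem wB_coords (h : S.IsExpanding I w κ R) {t : ℝ} (ht : t ∈ I) :
    wB κ (S.coords R t) = 1 / (3 * (S.hubble t ^ 2 - S.shear t ^ 2) * S.g₂₂ t) := by
  rw [wB, h.potential_coords ht]

theorem wM_coords (h : S.IsExpanding I w κ R) {t : ℝ} (ht : t ∈ I) :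
    wM κ (S.coords R t) =
      S.g₁₁ t / S.g₂₂ t / 4 / (3 * (S.hubble t ^ 2 - S.shear t ^ 2) * S.g₂₂ t) := by
  rw [wM, h.potential_coords ht, h.exp_v ht]

theorem wF_coords (h : S.IsExpanding I w κ R) {t : ℝ} (ht : t ∈ I) :
    wF κ (S.coords R t) =
      S.ρ t * S.g₂₂ t / (3 * (S.hubble t ^ 2 - S.shear t ^ 2) * S.g₂₂ t) := by
  have e : Real.exp (S.coords R t).2.1 = R t * S.g₂₂ t := by
    rw [coords, Real.exp_add, Real.exp_log (h.R_pos t ht),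
      Real.exp_log (h.isSolution.g₂₂_pos t ht)]
  rw [wF, h.potential_coords ht, e, h.ρ_eq t ht, ← mul_assoc κ]

theorem nB_coords (h : S.IsExpanding I w κ R) (hκ : 0 ≤ κ) {t : ℝ} (ht : t ∈ I) :
    nB κ (S.coords R t) = 1 / (3 * S.g₂₂ t * S.hubble t ^ 2) := by
  have h2 := h.isSolution.g₂₂_pos t ht
  have hH := h.hubble_pos t ht
  have hs : 0 < S.hubble t ^ 2 - S.shear t ^ 2 := by
    linarith [sq_lt_sq' (abs_lt.1 (h.abs_shear_lt hκ ht)).1 (abs_lt.1 (h.abs_shear_lt hκ ht)).2]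
  rw [nB, h.wB_coords ht, h.tanh_coords hκ ht]
  field_simp

theorem nM_coords (h : S.IsExpanding I w κ R) (hκ : 0 ≤ κ) {t : ℝ} (ht : t ∈ I) :
    12 * nM κ (S.coords R t) = (S.m₁ t / S.hubble t) ^ 2 := by
  have h1 := h.isSolution.g₁₁_pos t ht
  have h2 := h.isSolution.g₂₂_pos t ht
  have hH := h.hubble_pos t ht
  rw [nM_eq, h.nB_coords hκ ht, h.exp_v ht, div_pow, m₁_sq h1.le]
  field_simp
  norm_num

theorem nF_coords (h : S.IsExpanding I w κ R) (hκ : 0 ≤ κ) {t : ℝ} (ht : t ∈ I) :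
    nF κ (S.coords R t) = S.ρ t / (3 * S.hubble t ^ 2) := by
  have h2 := h.isSolution.g₂₂_pos t ht
  have hH := h.hubble_pos t ht
  have hs : 0 < S.hubble t ^ 2 - S.shear t ^ 2 := by
    linarith [sq_lt_sq' (abs_lt.1 (h.abs_shear_lt hκ ht)).1 (abs_lt.1 (h.abs_shear_lt hκ ht)).2]
  rw [nF, h.wF_coords ht, h.tanh_coords hκ ht]
  field_simp

theorem hasDerivAt_coords (h : S.IsExpanding I w κ R) (hκ : 0 ≤ κ) {t : ℝ} (ht : t ∈ I) :
    HasDerivAt (S.coords R) (S.hubble t • field κ (1 + 3 * w) (S.coords R t)) t := by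
  have h1 := h.isSolution.hasDerivAt_log_g₁₁ ht
  have h2 := h.isSolution.hasDerivAt_log_g₂₂ ht
  have hH := h.hubble_pos t ht
  have hg := h.isSolution.g₂₂_pos t ht
  have hx := abs_lt.1 (h.abs_shear_lt hκ ht)
  have hp : S.hubble t + S.shear t ≠ 0 := by linarith
  have hm : S.hubble t - S.shear t ≠ 0 := by linarith
  have hs : S.hubble t ^ 2 - S.shear t ^ 2 ≠ 0 := by
    rw [sq_sub_sq]; exact mul_ne_zero hp hm
  have hdH := h.isSolution.hasDerivAt_hubble ht
  have hdσ := h.isSolution.hasDerivAt_shear ht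
  refine HasDerivAt.prodMk ?_ (HasDerivAt.prodMk ?_ ?_)
  · refine (h1.fun_sub h2).congr_deriv ?_
    simp only [field, smul_eq_mul, h.tanh_coords hκ ht]
    field_simp
    ring
  · refine (((h.deriv_R t ht).log (h.R_pos t ht).ne').fun_add h2).congr_deriv ?_
    have := (h.R_pos t ht).ne'
    simp only [field, smul_eq_mul, h.tanh_coords hκ ht]
    field_simp
    ring
  · refine ((((hdH.fun_add hdσ).log hp).fun_sub
      ((hdH.fun_sub hdσ).log hm)).div_const 2).congr_deriv ?_
    have hc := h.isSolution.constraint ht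
    have e : S.g₁₁ t / S.g₂₂ t ^ 2 = 4 * (3 * (S.hubble t ^ 2 - S.shear t ^ 2) -
      1 / S.g₂₂ t - S.ρ t) := by linear_combination (-4) * hc
    have e' : S.g₁₁ t = 4 * (3 * (S.hubble t ^ 2 - S.shear t ^ 2) -
      1 / S.g₂₂ t - S.ρ t) * S.g₂₂ t ^ 2 := by
      rw [← e]; field_simp
    have eq1 : ∀ A B : ℝ, ((A + B) / (S.hubble t + S.shear t) - (A - B) / (S.hubble t - S.shear t)) / 2
        = (S.hubble t * B - S.shear t * A) / (S.hubble t ^ 2 - S.shear t ^ 2) := fun A B => by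
      rw [sq_sub_sq]
      field_simp
      ring
    simp only [field, smul_eq_mul, accel, h.tanh_coords hκ ht, h.wB_coords ht,
      h.wM_coords ht, h.wF_coords ht]
    rw [eq1, h.p_eq t ht, e']
    field_simp
    ring

/-- The state is a function of the reduced variables. -/
theorem stateX_eq (h : S.IsExpanding I w κ R) (hκ : 0 ≤ κ) {t : ℝ} (ht : t ∈ I) :
    S.stateX t = toState κ (S.coords R t) := by
  have h2 := h.isSolution.g₂₂_pos t ht
  have hH := h.hubble_pos t ht
  have hb : 0 < 1 - nB κ (S.coords R t) := by linarith [nB_lt_one (S.coords R t) hκ]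
  have hsq := Real.sqrt_pos.2 hb
  have hD : S.dominant t = S.hubble t * √(1 - nB κ (S.coords R t)) := by
    rw [dominant, ← Real.sqrt_sq hH.le, ← Real.sqrt_mul (sq_nonneg _), h.nB_coords hκ ht,
      Real.sqrt_sq hH.le]
    congr 1
    field_simp
  have hm : 0 ≤ S.m₁ t / S.hubble t :=
    div_nonneg (div_nonneg (Real.sqrt_nonneg _) h2.le) hH.le
  rw [stateX, toState, h.nM_coords hκ ht, Real.sqrt_sq hm, h.tanh_coords hκ ht, hD]
  refine Prod.ext ?_ (Prod.ext ?_ ?_)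
  · field_simp
  · field_simp
  · field_simp

end IsExpanding

end LRSModel

/-! ### Reconstruction of the spacetime from an orbit -/

namespace LRSModel

open Reduced

section Reconstruction

variable {κ w T₀ : ℝ} {Y : ℝ → ℝ × ℝ × ℝ}

/-- The metric component `g₂₂` along an orbit `Y`, as a function of the logarithmic time `u` since the
instant with logarithmic time `T₀`. -/
noncomputable def orbitG₂₂ (T₀ : ℝ) (Y : ℝ → ℝ × ℝ × ℝ) (u : ℝ) : ℝ :=
  Real.exp (2 * (T₀ + u) - (Y u).1 / 3)

/-- The metric component `g₁₁` along an orbit. -/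
noncomputable def orbitG₁₁ (T₀ : ℝ) (Y : ℝ → ℝ × ℝ × ℝ) (u : ℝ) : ℝ :=
  Real.exp (Y u).1 * orbitG₂₂ T₀ Y u

/-- The Hubble scalar along an orbit. -/
noncomputable def orbitH (κ T₀ : ℝ) (Y : ℝ → ℝ × ℝ × ℝ) (u : ℝ) : ℝ :=
  (√(3 * orbitG₂₂ T₀ Y u * nB κ (Y u)))⁻¹

/-- The model determined by an orbit, if `θ` expresses the logarithmic time by the proper time. -/
noncomputable def ofOrbit (κ w T₀ : ℝ) (Y : ℝ → ℝ × ℝ × ℝ) (θ : ℝ → ℝ) : LRSModel where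
  g₁₁ t := orbitG₁₁ T₀ Y (θ t)
  g₂₂ t := orbitG₂₂ T₀ Y (θ t)
  k₁ t := orbitH κ T₀ Y (θ t) * (-1 + 2 * Real.tanh (Y (θ t)).2.2)
  k₂ t := orbitH κ T₀ Y (θ t) * (-1 - Real.tanh (Y (θ t)).2.2)
  ρ t := 3 * orbitH κ T₀ Y (θ t) ^ 2 * nF κ (Y (θ t))
  p t := w * (3 * orbitH κ T₀ Y (θ t) ^ 2 * nF κ (Y (θ t)))

theorem orbitG₂₂_pos (u : ℝ) : 0 < orbitG₂₂ T₀ Y u := Real.exp_pos _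

theorem orbitG₁₁_pos (u : ℝ) : 0 < orbitG₁₁ T₀ Y u := mul_pos (Real.exp_pos _) (orbitG₂₂_pos u)

theorem orbitH_pos (hκ : 0 ≤ κ) (u : ℝ) : 0 < orbitH κ T₀ Y u :=
  inv_pos.2 (Real.sqrt_pos.2 (mul_pos (mul_pos three_pos (orbitG₂₂_pos u)) (nB_pos _ hκ)))

theorem one_div_orbitG₂₂ (hκ : 0 ≤ κ) (u : ℝ) :
    1 / orbitG₂₂ T₀ Y u = 3 * orbitH κ T₀ Y u ^ 2 * nB κ (Y u) := by
  have h1 := orbitG₂₂_pos (T₀ := T₀) (Y := Y) u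
  have h2 := nB_pos (Y u) hκ
  rw [orbitH, inv_pow, Real.sq_sqrt (by positivity)]
  field_simp

theorem orbitG₁₁_div_sq (hκ : 0 ≤ κ) (u : ℝ) :
    orbitG₁₁ T₀ Y u / orbitG₂₂ T₀ Y u ^ 2 = 12 * orbitH κ T₀ Y u ^ 2 * nM κ (Y u) := by
  have h1 := orbitG₂₂_pos (T₀ := T₀) (Y := Y) u
  have e : orbitG₁₁ T₀ Y u / orbitG₂₂ T₀ Y u ^ 2 = Real.exp (Y u).1 * (1 / orbitG₂₂ T₀ Y u) := by
    rw [orbitG₁₁]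
    field_simp
  rw [e, one_div_orbitG₂₂ hκ, nM_eq]
  ring

variable (hY : ∀ u, HasDerivAt Y (field κ (1 + 3 * w) (Y u)) u)

include hY in
theorem hasDerivAt_orbitG₂₂ (u : ℝ) : HasDerivAt (orbitG₂₂ T₀ Y)
    (orbitG₂₂ T₀ Y u * (2 + 2 * Real.tanh (Y u).2.2)) u := by
  refine ((((hasDerivAt_id u).const_add T₀).const_mul 2).fun_sub
    ((hasDerivAt_v hY u).div_const 3)).exp.congr_deriv ?_
  rw [orbitG₂₂]
  simp only [id]
  ring

include hY in
theorem hasDerivAt_orbitG₁₁ (u : ℝ) : HasDerivAt (orbitG₁₁ T₀ Y)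
    (orbitG₁₁ T₀ Y u * (2 - 4 * Real.tanh (Y u).2.2)) u := by
  refine ((hasDerivAt_v hY u).exp.fun_mul (hasDerivAt_orbitG₂₂ hY u)).congr_deriv ?_
  rw [orbitG₁₁]
  ring

include hY in
theorem hasDerivAt_orbitH (hκ : 0 ≤ κ) (u : ℝ) : HasDerivAt (orbitH κ T₀ Y)
    (-(1 + decel κ (1 + 3 * w) (Y u)) * orbitH κ T₀ Y u) u := by
  have h1 := orbitG₂₂_pos (T₀ := T₀) (Y := Y) u
  have h2 := nB_pos (Y u) hκ
  have h3 : 0 < 3 * orbitG₂₂ T₀ Y u * nB κ (Y u) := by positivity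
  have h4 := Real.sqrt_pos.2 h3
  refine (((((hasDerivAt_orbitG₂₂ hY u).const_mul 3).fun_mul
    (hasDerivAt_nB hκ hY u)).sqrt h3.ne').fun_inv h4.ne').congr_deriv ?_
  rw [orbitH]
  have h5 := Real.sq_sqrt h3.le
  set r := √(3 * orbitG₂₂ T₀ Y u * nB κ (Y u))
  field_simp
  linear_combination (1 + decel κ (1 + 3 * w) (Y u)) * h5

include hY in
/-- The model determined by an orbit satisfies the Einstein equations. -/
theorem isSolution_ofOrbit (hκ : 0 ≤ κ) {θ : ℝ → ℝ} {J : Set ℝ} (hJ : IsOpen J)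
    (hJ' : J.OrdConnected) (hJ0 : J.Nonempty)
    (hθ : ∀ t ∈ J, HasDerivAt θ (orbitH κ T₀ Y (θ t)) t) : (ofOrbit κ w T₀ Y θ).IsSolution J := by
  set S := ofOrbit κ w T₀ Y θ with hS
  have g1 : ∀ t, 0 < S.g₁₁ t := fun t => orbitG₁₁_pos _
  have g2 : ∀ t, 0 < S.g₂₂ t := fun t => orbitG₂₂_pos _
  have e1 : ∀ t, S.g₁₁ t / S.g₂₂ t ^ 2 = 12 * orbitH κ T₀ Y (θ t) ^ 2 * nM κ (Y (θ t)) :=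
    fun t => orbitG₁₁_div_sq hκ (θ t)
  have e2 : ∀ t, 1 / S.g₂₂ t = 3 * orbitH κ T₀ Y (θ t) ^ 2 * nB κ (Y (θ t)) :=
    fun t => one_div_orbitG₂₂ hκ (θ t)
  have r1 : ∀ t, S.ric₁ t = 6 * orbitH κ T₀ Y (θ t) ^ 2 * nM κ (Y (θ t)) := fun t => by
    rw [ric₁_eq (g1 t).le, e1]
    ring
  have r2 : ∀ t, S.ric₂ t = -(3 * orbitH κ T₀ Y (θ t) ^ 2 * nB κ (Y (θ t))) -
      6 * orbitH κ T₀ Y (θ t) ^ 2 * nM κ (Y (θ t)) := fun t => by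
    rw [ric₂_eq (g1 t), e1, e2]
    ring
  have tr : ∀ t, S.trK t = -3 * orbitH κ T₀ Y (θ t) := fun t => by
    simp only [trK, hS, ofOrbit]
    ring
  refine ⟨hJ, hJ', hJ0, fun t _ => g1 t, fun t _ => g2 t, fun t ht => ?_, fun t ht => ?_,
    fun t ht => ?_, fun t ht => ?_, fun t ht => ?_⟩
  · refine ((hasDerivAt_orbitG₁₁ hY (θ t)).comp t (hθ t ht)).congr_deriv ?_
    simp only [hS, ofOrbit]
    ring
  · refine ((hasDerivAt_orbitG₂₂ hY (θ t)).comp t (hθ t ht)).congr_deriv ?_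
    simp only [hS, ofOrbit]
    ring
  · refine (((hasDerivAt_orbitH hY hκ (θ t)).fun_mul (((hasDerivAt_x hY (θ t)).const_mul
      2).const_add (-1))).comp t (hθ t ht)).congr_deriv ?_
    rw [r1, tr]
    simp only [hS, ofOrbit, decel]
    linear_combination (2 * orbitH κ T₀ Y (θ t) ^ 2) * n_sum (Y (θ t)) hκ
  · refine (((hasDerivAt_orbitH hY hκ (θ t)).fun_mul
      ((hasDerivAt_x hY (θ t)).const_sub (-1))).comp t (hθ t ht)).congr_deriv ?_
    rw [r2, tr]
    simp only [hS, ofOrbit, decel]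
    linear_combination (2 * orbitH κ T₀ Y (θ t) ^ 2) * n_sum (Y (θ t)) hκ
  · rw [r1, r2, tr]
    simp only [hS, ofOrbit]
    linear_combination (-6 * orbitH κ T₀ Y (θ t) ^ 2) * n_sum (Y (θ t)) hκ

end Reconstruction

/-! ### Inextendible solutions exhaust the logarithmic time -/

namespace IsExpanding

variable {S : LRSModel} {I : Set ℝ} {w κ : ℝ} {R : ℝ → ℝ}

/-- In the logarithmic time, the reduced variables follow the reduced flow. -/
theorem coords_eq_flow (h : S.IsExpanding I w κ R) (hκ : 0 ≤ κ) (hw : w ∈ Ioo (-1 / 3 : ℝ) 1)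
    {φ : ℝ → ℝ × ℝ × ℝ → ℝ × ℝ × ℝ} (hφ : IsGlobalFlow (field κ (1 + 3 * w)) φ) {t₀ t : ℝ}
    (ht₀ : t₀ ∈ I) (ht : t ∈ I) :
    S.coords R t = φ (S.logTime t - S.logTime t₀) (S.coords R t₀) := by
  have hlip := lipschitzWith_field hκ (by linarith [hw.1] : 0 < 1 + 3 * w) (by linarith [hw.2])
  have hI := h.isSolution.isOpen
  obtain ⟨a, haI, ha⟩ : ∃ a ∈ I, a < min t₀ t := by
    have hm : min t₀ t ∈ I := by rcases min_choice t₀ t with e | e <;> rw [e] <;> assumption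
    have h1 : ∀ᶠ x in 𝓝[<] (min t₀ t), x ∈ I := nhdsWithin_le_nhds (hI.mem_nhds hm)
    obtain ⟨a, h1, h2⟩ := (h1.and self_mem_nhdsWithin).exists
    exact ⟨a, h1, h2⟩
  obtain ⟨b, hbI, hb⟩ : ∃ b ∈ I, max t₀ t < b := by
    have hm : max t₀ t ∈ I := by rcases max_choice t₀ t with e | e <;> rw [e] <;> assumption
    have h1 : ∀ᶠ x in 𝓝[>] (max t₀ t), x ∈ I := nhdsWithin_le_nhds (hI.mem_nhds hm)
    obtain ⟨a, h1, h2⟩ := (h1.and self_mem_nhdsWithin).exists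
    exact ⟨a, h1, h2⟩
  have hab : Icc a b ⊆ I := h.isSolution.ordConnected.out haI hbI
  obtain ⟨C, hC⟩ := isCompact_Icc.exists_bound_of_continuousOn (s := Icc a b) (f := S.hubble)
    fun u hu => (h.isSolution.hasDerivAt_hubble (hab hu)).continuousAt.continuousWithinAt
  have hsub : Ioo a b ⊆ I := Ioo_subset_Icc_self.trans hab
  refine ODE_solution_unique_of_mem_Ioo (a := a) (b := b) (t₀ := t₀) (K := C.toNNReal * 22)
    (v := fun u y => S.hubble u • field κ (1 + 3 * w) y) (s := fun _ => univ)
    (f := S.coords R) (g := fun u => φ (S.logTime u - S.logTime t₀) (S.coords R t₀))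
    (fun u hu => (LipschitzWith.of_dist_le_mul fun y z => ?_).lipschitzOnWith)
    ⟨ha.trans_le (min_le_left _ _), (le_max_left _ _).trans_lt hb⟩
    (fun u hu => ⟨h.hasDerivAt_coords hκ (hsub hu), trivial⟩)
    (fun u hu => ⟨?_, trivial⟩) (by simp [hφ.zero])
    ⟨ha.trans_le (min_le_right _ _), (le_max_right _ _).trans_lt hb⟩
  · rw [dist_eq_norm, dist_eq_norm, ← smul_sub, norm_smul, NNReal.coe_mul, mul_assoc]
    have h1 := hC u (Ioo_subset_Icc_self hu)
    exact mul_le_mul (h1.trans (Real.le_coe_toNNReal C)) (hlip.norm_sub_le y z) (norm_nonneg _)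
      (NNReal.coe_nonneg _)
  · exact (hφ.hasDerivAt (S.coords R t₀) _).scomp u
      ((h.isSolution.hasDerivAt_logTime (hsub hu)).sub_const _)

/-- An expanding solution is the restriction of the model determined by its whole orbit. If that model
does not extend the solution, then the logarithmic time takes all values. -/
theorem exists_extension (h : S.IsExpanding I w κ R) (hκ : 0 ≤ κ) (hw : w ∈ Ioo (-1 / 3 : ℝ) 1)
    {φ : ℝ → ℝ × ℝ × ℝ → ℝ × ℝ × ℝ} (hφ : IsGlobalFlow (field κ (1 + 3 * w)) φ) {t₀ : ℝ}
    (ht₀ : t₀ ∈ I) :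
    ∃ (θ : ℝ → ℝ) (J : Set ℝ),
      (ofOrbit κ w (S.logTime t₀) (fun u => φ u (S.coords R t₀)) θ).IsSolution J ∧ I ⊆ J ∧
      S.AgreeOn (ofOrbit κ w (S.logTime t₀) (fun u => φ u (S.coords R t₀)) θ) I ∧
      (J ⊆ I → ∀ u, ∃ t ∈ I, S.logTime t - S.logTime t₀ = u) := by
  set Y : ℝ → ℝ × ℝ × ℝ := fun u => φ u (S.coords R t₀) with hYdef
  set T₀ := S.logTime t₀ with hT₀
  have hY : ∀ u, HasDerivAt Y (field κ (1 + 3 * w) (Y u)) u := hφ.hasDerivAt _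
  have hHpos : ∀ u, 0 < orbitH κ T₀ Y u := orbitH_pos hκ
  have hcont : Continuous fun u => (orbitH κ T₀ Y u)⁻¹ :=
    (continuous_iff_continuousAt.2 fun u => (hasDerivAt_orbitH hY hκ u).continuousAt).inv₀
      fun u => (hHpos u).ne'
  -- The proper time as a function of the logarithmic time.
  set T : ℝ → ℝ := fun u => t₀ + ∫ v in (0 : ℝ)..u, (orbitH κ T₀ Y v)⁻¹ with hT
  have hTd : ∀ u, HasStrictDerivAt T (orbitH κ T₀ Y u)⁻¹ u := fun u =>
    (hcont.integral_hasStrictDerivAt 0 u).const_add t₀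
  have hTmono : StrictMono T := strictMono_of_deriv_pos fun u => by
    rw [(hTd u).hasDerivAt.deriv]
    exact inv_pos.2 (hHpos u)
  have hTcont : Continuous T := continuous_iff_continuousAt.2 fun u =>
    (hTd u).hasDerivAt.continuousAt
  set θ := Function.invFun T
  have hθ : ∀ u, θ (T u) = u := Function.leftInverse_invFun hTmono.injective
  have hθd : ∀ t ∈ range T, HasDerivAt θ (orbitH κ T₀ Y (θ t)) t := by
    rintro _ ⟨u, rfl⟩
    have := ((hTd u).to_local_left_inverse (inv_ne_zero (hHpos u).ne')
      (Eventually.of_forall hθ)).hasDerivAt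
    rw [inv_inv] at this
    rwa [hθ u]
  -- The quantities of the given solution are those of the orbit.
  have hYt : ∀ t ∈ I, Y (S.logTime t - T₀) = S.coords R t := fun t ht =>
    (h.coords_eq_flow hκ hw hφ ht₀ ht).symm
  have hg2 : ∀ t ∈ I, orbitG₂₂ T₀ Y (S.logTime t - T₀) = S.g₂₂ t := fun t ht => by
    rw [orbitG₂₂, hYt t ht, ← Real.exp_log (h.isSolution.g₂₂_pos t ht)]
    congr 1
    simp only [coords, logTime]
    ring
  have hg1 : ∀ t ∈ I, orbitG₁₁ T₀ Y (S.logTime t - T₀) = S.g₁₁ t := fun t ht => by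
    have := h.isSolution.g₂₂_pos t ht
    rw [orbitG₁₁, hg2 t ht, hYt t ht, h.exp_v ht]
    field_simp
  have hH : ∀ t ∈ I, orbitH κ T₀ Y (S.logTime t - T₀) = S.hubble t := fun t ht => by
    have h1 := h.isSolution.g₂₂_pos t ht
    have h2 := h.hubble_pos t ht
    rw [orbitH, hg2 t ht, hYt t ht, h.nB_coords hκ ht, inv_eq_iff_eq_inv,
      Real.sqrt_eq_iff_mul_self_eq (by positivity) (by positivity)]
    field_simp
  have hTt : ∀ t ∈ I, T (S.logTime t - T₀) = t := by
    have hd : ∀ t ∈ I, HasDerivAt (fun t => T (S.logTime t - T₀) - t) 0 t := fun t ht => by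
      refine (((hTd _).hasDerivAt.comp t ((h.isSolution.hasDerivAt_logTime ht).sub_const
        T₀)).fun_sub (hasDerivAt_id t)).congr_deriv ?_
      rw [hH t ht, inv_mul_cancel₀ (h.hubble_pos t ht).ne', sub_self]
    intro t ht
    have := h.isSolution.isOpen.is_const_of_deriv_eq_zero
      h.isSolution.ordConnected.isPreconnected
      (fun t ht => (hd t ht).differentiableAt.differentiableWithinAt)
      (fun t ht => (hd t ht).deriv) ht ht₀
    simp only [hT₀, sub_self, hT, intervalIntegral.integral_same, add_zero] at this
    simp only [hT]
    linarith
  have hθt : ∀ t ∈ I, θ t = S.logTime t - T₀ := fun t ht => by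
    conv_lhs => rw [← hTt t ht]
    exact hθ _
  refine ⟨θ, range T, isSolution_ofOrbit hY hκ ?_ ?_ ⟨T 0, mem_range_self 0⟩ hθd, ?_, ?_, ?_⟩
  · exact (isOpenMap_of_hasStrictDerivAt hTd fun u => inv_ne_zero (hHpos u).ne').isOpen_range
  · exact (isPreconnected_range hTcont).ordConnected
  · exact fun t ht => ⟨_, hTt t ht⟩
  · intro t ht
    have hx := h.tanh_coords hκ ht
    have hn := h.nF_coords hκ ht
    have hH0 := h.hubble_pos t ht
    have hρ : S.ρ t = 3 * S.hubble t ^ 2 * nF κ (S.coords R t) := by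
      rw [hn]; field_simp
    simp only [ofOrbit, hθt t ht, hg1 t ht, hg2 t ht, hH t ht, hYt t ht, hx]
    refine ⟨trivial, trivial, ?_, ?_, hρ, ?_⟩
    · rw [k₁_eq]; field_simp
    · rw [k₂_eq]; field_simp
    · rw [h.p_eq t ht, ← hρ]
  · intro hJ u
    refine ⟨T u, hJ (mem_range_self u), hTmono.injective (hTt _ (hJ (mem_range_self u)))⟩

/-- If the logarithmic time takes all values, then limits along the solution are limits along the
orbit. -/
theorem tendsto_stateX (h : S.IsExpanding I w κ R) (hκ : 0 ≤ κ) (hw : w ∈ Ioo (-1 / 3 : ℝ) 1)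
    {φ : ℝ → ℝ × ℝ × ℝ → ℝ × ℝ × ℝ} (hφ : IsGlobalFlow (field κ (1 + 3 * w)) φ) {t₀ : ℝ}
    (ht₀ : t₀ ∈ I) (hsurj : ∀ u, ∃ t ∈ I, S.logTime t - S.logTime t₀ = u)
    {f : ℝ × ℝ × ℝ → ℝ × ℝ × ℝ} {y : ℝ × ℝ × ℝ} :
    (Tendsto (fun u => f (toState κ (φ u (S.coords R t₀)))) atBot (𝓝 y) →
      Tendsto (fun t : I => f (S.stateX t)) atBot (𝓝 y)) ∧
    (Tendsto (fun u => f (toState κ (φ u (S.coords R t₀)))) atTop (𝓝 y) →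
      Tendsto (fun t : I => f (S.stateX t)) atTop (𝓝 y)) := by
  have hmono : Monotone fun t : I => S.logTime t - S.logTime t₀ := by
    have := monotoneOn_of_deriv_nonneg h.isSolution.ordConnected.convex (f := S.logTime)
      (fun t ht => (h.isSolution.hasDerivAt_logTime ht).continuousAt.continuousWithinAt)
      (fun t ht => (h.isSolution.hasDerivAt_logTime
        (interior_subset ht)).differentiableAt.differentiableWithinAt)
      fun t ht => by
        rw [(h.isSolution.hasDerivAt_logTime (interior_subset ht)).deriv]
        exact (h.hubble_pos t (interior_subset ht)).le
    exact fun a b hab => sub_le_sub_right (this a.2 b.2 hab) _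
  have e : (fun t : I => f (S.stateX t)) =
      (fun u => f (toState κ (φ u (S.coords R t₀)))) ∘ fun t : I => S.logTime t - S.logTime t₀ := by
    funext t
    simp only [Function.comp_apply, h.stateX_eq hκ t.2, h.coords_eq_flow hκ hw hφ ht₀ t.2]
  rw [e]
  constructor
  · intro hf
    refine hf.comp (tendsto_atBot_atBot_of_monotone hmono fun u => ?_)
    obtain ⟨t, ht, htu⟩ := hsurj u
    exact ⟨⟨t, ht⟩, htu.le⟩
  · intro hf
    refine hf.comp (tendsto_atTop_atTop_of_monotone hmono fun u => ?_)
    obtain ⟨t, ht, htu⟩ := hsurj u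
    exact ⟨⟨t, ht⟩, htu.ge⟩

end IsExpanding

end LRSModel

/-! ### The generic set of states -/

namespace Reduced

/-- The inverse of `Reduced.toState 1`, on `XVIII`. -/
noncomputable def ofState (x : ℝ × ℝ × ℝ) : ℝ × ℝ × ℝ :=
  (Real.log (x.2.2 ^ 2 / (3 * (x.1 ^ 2 - 1))),
    Real.log ((1 - x.2.1 ^ 2 - x.2.2 ^ 2 / 12) / (x.1 ^ 2 - 1)), Real.artanh (x.2.1 / x.1))

theorem ofState_toState (p : ℝ × ℝ × ℝ) : ofState (toState 1 p) = p := by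
  have hb := nB_pos p zero_le_one
  have hb1 : 0 < 1 - nB 1 p := by linarith [nB_lt_one p zero_le_one]
  have hm := nM_pos p zero_le_one
  have hF : nF 1 p = Real.exp p.2.1 * nB 1 p := by rw [nF, nB, wF_eq]; ring
  have hsum := n_sum p zero_le_one
  have hsq := Real.sq_sqrt hb1.le
  have hs := Real.sqrt_pos.2 hb1
  have e1 : (toState 1 p).1 ^ 2 - 1 = nB 1 p / (1 - nB 1 p) := by
    rw [toState, div_pow, hsq]
    field_simp
    ring
  have e2 : (toState 1 p).2.2 ^ 2 = 12 * nM 1 p / (1 - nB 1 p) := by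
    rw [toState, div_pow, hsq, Real.sq_sqrt (by positivity)]
  have e3 : (toState 1 p).2.1 ^ 2 = Real.tanh p.2.2 ^ 2 / (1 - nB 1 p) := by
    rw [toState, div_pow, hsq]
  have e4 : (toState 1 p).2.1 / (toState 1 p).1 = Real.tanh p.2.2 := by
    simp only [toState]
    field_simp
  have e5 : 12 * nM 1 p / (1 - nB 1 p) / (3 * (nB 1 p / (1 - nB 1 p))) = Real.exp p.1 := by
    rw [nM_eq]
    field_simp
    norm_num
  have e6 : (1 - Real.tanh p.2.2 ^ 2 / (1 - nB 1 p) - 12 * nM 1 p / (1 - nB 1 p) / 12) /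
      (nB 1 p / (1 - nB 1 p)) = Real.exp p.2.1 := by
    field_simp
    linear_combination hF - hsum
  rw [ofState, e1, e2, e3, e4, e5, e6, Real.log_exp, Real.log_exp, Real.artanh_tanh]

/-- The quantities that occur in `Reduced.ofState` are positive. -/
theorem pos_of_mem_XVIII {x : ℝ × ℝ × ℝ} (hx : x ∈ XVIII) :
    1 < x.1 ∧ 0 < x.2.2 ∧ 0 < x.1 ^ 2 - 1 ∧ 0 < 1 - x.2.1 ^ 2 - x.2.2 ^ 2 / 12 ∧
      x.2.1 / x.1 ∈ Ioo (-1 : ℝ) 1 := by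
  obtain ⟨h1, ⟨h2, h3⟩, h4, h5⟩ := hx
  have h6 := (Real.lt_sqrt h4.le).1 h5
  have h0 : 0 < x.1 := by linarith
  refine ⟨h1, h4, by nlinarith, by linarith, ?_, ?_⟩
  · rw [lt_div_iff₀ h0]; linarith
  · rw [div_lt_iff₀ h0]; linarith

theorem toState_ofState {x : ℝ × ℝ × ℝ} (hx : x ∈ XVIII) : toState 1 (ofState x) = x := by
  obtain ⟨h1, h2, h3, h4, h5⟩ := pos_of_mem_XVIII hx
  have h0 : 0 < x.1 := by linarith
  have ht : Real.tanh (ofState x).2.2 = x.2.1 / x.1 := Real.tanh_artanh h5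
  have hv : Real.exp (ofState x).1 = x.2.2 ^ 2 / (3 * (x.1 ^ 2 - 1)) :=
    Real.exp_log (by positivity)
  have hζ : Real.exp (ofState x).2.1 = (1 - x.2.1 ^ 2 - x.2.2 ^ 2 / 12) / (x.1 ^ 2 - 1) :=
    Real.exp_log (by positivity)
  have h6 : 0 < x.1 ^ 2 - x.2.1 ^ 2 := by nlinarith [sq_nonneg x.2.2]
  have hU : potential 1 (ofState x) = (x.1 ^ 2 - x.2.1 ^ 2) / (x.1 ^ 2 - 1) := by
    rw [potential, hv, hζ]
    field_simp
    ring
  have hB : nB 1 (ofState x) = (x.1 ^ 2 - 1) / x.1 ^ 2 := by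
    rw [nB, wB, hU, ht]
    field_simp
  have hM : 12 * nM 1 (ofState x) = (x.2.2 / x.1) ^ 2 := by
    rw [nM_eq, hB, hv]
    field_simp
    norm_num
  have hr : √(1 - nB 1 (ofState x)) = 1 / x.1 := by
    rw [hB, Real.sqrt_eq_iff_mul_self_eq (by field_simp; linarith) (by positivity)]
    field_simp
    ring
  rw [toState, hr, hM, Real.sqrt_sq (by positivity), ht]
  refine Prod.ext ?_ (Prod.ext ?_ ?_)
  · field_simp
  · field_simp
  · field_simp

theorem continuousOn_ofState : ContinuousOn ofState XVIII := by
  intro x hx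
  obtain ⟨h1, h2, h3, h4, h5⟩ := pos_of_mem_XVIII hx
  have h0 : x.1 ≠ 0 := by linarith
  have h6 : 1 - x.2.1 / x.1 ≠ 0 := by linarith [h5.2]
  have h7 : √((1 + x.2.1 / x.1) / (1 - x.2.1 / x.1)) ≠ 0 :=
    (Real.sqrt_pos.2 (div_pos (by linarith [h5.1]) (by linarith [h5.2]))).ne'
  have h8 : x.2.2 ^ 2 / (3 * (x.1 ^ 2 - 1)) ≠ 0 := by positivity
  have h9 : (1 - x.2.1 ^ 2 - x.2.2 ^ 2 / 12) / (x.1 ^ 2 - 1) ≠ 0 := by positivity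
  have h10 : 3 * (x.1 ^ 2 - 1) ≠ 0 := by positivity
  unfold ofState Real.artanh
  refine ContinuousAt.continuousWithinAt ?_
  fun_prop (disch := first | assumption | exact h3.ne')

theorem differentiable_toState : Differentiable ℝ (toState 1) := by
  intro p
  have htanh : DifferentiableAt ℝ (fun p : ℝ × ℝ × ℝ => Real.tanh p.2.2) p :=
    DifferentiableAt.comp (g := Real.tanh) p (Real.hasDerivAt_tanh p.2.2).differentiableAt
      (by fun_prop)
  have hU := (potential_pos p zero_le_one).ne'
  have hwB : DifferentiableAt ℝ (wB 1) p := by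
    unfold wB
    unfold potential at hU ⊢
    fun_prop (disch := assumption)
  have hB : DifferentiableAt ℝ (nB 1) p := hwB.fun_mul ((htanh.fun_pow 2).const_sub 1)
  have hM : DifferentiableAt ℝ (nM 1) p := by
    have : nM 1 = fun p => Real.exp p.1 / 4 * nB 1 p := funext fun p => nM_eq p
    rw [this]
    fun_prop
  have hb1 : 1 - nB 1 p ≠ 0 := by linarith [nB_lt_one p zero_le_one]
  have hm : 12 * nM 1 p ≠ 0 := by linarith [nM_pos p zero_le_one]
  have hs : √(1 - nB 1 p) ≠ 0 :=
    (Real.sqrt_pos.2 (by linarith [nB_lt_one p zero_le_one])).ne'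
  unfold toState
  fun_prop (disch := assumption)

theorem isOpen_XVIII : IsOpen XVIII := by
  have : XVIII = {x : ℝ × ℝ × ℝ | 1 < x.1} ∩ ({x | -1 < x.2.1} ∩ {x | x.2.1 < 1}) ∩
      ({x | 0 < x.2.2} ∩ {x | x.2.2 < √(12 * (1 - x.2.1 ^ 2))}) := by
    ext x
    simp only [XVIII, mem_ofPred_eq, mem_inter_iff, mem_Ioo, and_assoc]
  rw [this]
  exact ((isOpen_lt (by fun_prop) (by fun_prop)).inter
    ((isOpen_lt (by fun_prop) (by fun_prop)).inter (isOpen_lt (by fun_prop) (by fun_prop)))).inter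
    ((isOpen_lt (by fun_prop) (by fun_prop)).inter (isOpen_lt (by fun_prop) (by fun_prop)))

/-- The states whose fluid orbit, under the reduced flow `φ`, has negative shear at some time in the
past. -/
def genericStates (φ : ℝ → ℝ × ℝ × ℝ → ℝ × ℝ × ℝ) : Set (ℝ × ℝ × ℝ) :=
  XVIII ∩ ofState ⁻¹' ⋃ τ ≤ (0 : ℝ), {p | (φ τ p).2.2 < 0}

theorem isOpen_genericStates {s : ℝ} (hs0 : 0 < s) (hs4 : s < 4)
    {φ : ℝ → ℝ × ℝ × ℝ → ℝ × ℝ × ℝ} (hφ : IsGlobalFlow (field 1 s) φ) :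
    IsOpen (genericStates φ) := by
  refine continuousOn_ofState.isOpen_inter_preimage isOpen_XVIII
    (isOpen_biUnion fun τ _ => isOpen_lt ?_ continuous_const)
  exact (hφ.continuous (lipschitzWith_field zero_le_one hs0 hs4) τ).snd.snd

theorem volume_diff_genericStates {s : ℝ} (hs0 : 0 < s) (hs4 : s < 4)
    {φ : ℝ → ℝ × ℝ × ℝ → ℝ × ℝ × ℝ} (hφ : IsGlobalFlow (field 1 s) φ) :
    volume (XVIII \ genericStates φ) = 0 := by
  have : (volume : Measure (ℝ × ℝ × ℝ)).IsAddHaarMeasure := Measure.prod.instIsAddHaarMeasure _ _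
  refine measure_mono_null (t := toState 1 '' {p | ∀ τ ≤ 0, 0 ≤ (φ τ p).2.2}) ?_
    (addHaar_image_eq_zero_of_differentiableOn_of_addHaar_eq_zero volume
      differentiable_toState.differentiableOn (volume_forall_nonneg_eq_zero hs0 hs4 hφ))
  rintro x ⟨hx, hxG⟩
  refine ⟨ofState x, fun τ hτ => ?_, toState_ofState hx⟩
  by_contra! hneg
  exact hxG ⟨hx, mem_biUnion hτ hneg⟩

end Reduced

/-! ### Asymptotics of maximal solutions -/

namespace LRSModel

open Reduced

variable {S : LRSModel} {I : Set ℝ}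

/-- A maximal vacuum solution is parametrised by the whole real line of logarithmic times. -/
theorem IsMaximal.exists_logTime_of_vacuum (hS : IsMaximal IsVacuum S I) {R : ℝ → ℝ}
    (h : S.IsExpanding I 0 0 R) {φ : ℝ → ℝ × ℝ × ℝ → ℝ × ℝ × ℝ}
    (hφ : IsGlobalFlow (field 0 (1 + 3 * 0)) φ) {t₀ : ℝ} (ht₀ : t₀ ∈ I) (u : ℝ) :
    ∃ t ∈ I, S.logTime t - S.logTime t₀ = u := by
  obtain ⟨θ, J, hJ, hIJ, hag, hex⟩ := h.exists_extension le_rfl (by norm_num) hφ ht₀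
  exact hex (hS.2 _ J ⟨hJ, fun t _ => by simp [ofOrbit, nF, wF]⟩ hIJ hag) u

/-- A maximal fluid solution is parametrised by the whole real line of logarithmic times. -/
theorem IsMaximal.exists_logTime_of_linearFluid {w : ℝ} (hw : w ∈ Ioo (-1 / 3 : ℝ) 1)
    (hS : IsMaximal (IsLinearFluid w) S I) {R : ℝ → ℝ} (h : S.IsExpanding I w 1 R)
    {φ : ℝ → ℝ × ℝ × ℝ → ℝ × ℝ × ℝ} (hφ : IsGlobalFlow (field 1 (1 + 3 * w)) φ) {t₀ : ℝ}
    (ht₀ : t₀ ∈ I) (u : ℝ) : ∃ t ∈ I, S.logTime t - S.logTime t₀ = u := by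
  obtain ⟨θ, J, hJ, hIJ, hag, hex⟩ := h.exists_extension zero_le_one hw hφ ht₀
  refine hex (hS.2 _ J ⟨hJ, fun t _ => ⟨?_, rfl⟩⟩ hIJ hag) u
  have hF : 0 < nF 1 (φ (θ t) (S.coords R t₀)) :=
    mul_pos (div_pos (by positivity) (potential_pos _ zero_le_one))
      (by linarith [Real.tanh_sq_lt_one (φ (θ t) (S.coords R t₀)).2.2])
  have hH := orbitH_pos (κ := 1) (T₀ := S.logTime t₀) (Y := fun u => φ u (S.coords R t₀))
    zero_le_one (θ t)
  simp only [ofOrbit]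
  positivity

theorem IsMaximal.tendsto_of_vacuum (hS : IsMaximal IsVacuum S I) (hH : ∀ t ∈ I, 0 < S.hubble t) :
    Tendsto (fun t : I => toY (S.stateX t)) atBot (𝓝 pointTflat) ∧
      Tendsto (fun t : I => toY (S.stateX t)) atTop (𝓝 pointD) := by
  have h := hS.1.isExpanding hH
  obtain ⟨t₀, ht₀⟩ := h.isSolution.nonempty
  have hs0 : (0 : ℝ) < 1 + 3 * 0 := by norm_num
  have hs4 : (1 + 3 * 0 : ℝ) < 4 := by norm_num
  obtain ⟨φ, hφ⟩ := exists_flow (le_refl (0 : ℝ)) hs0 hs4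
  have hlim := fun y => h.tendsto_stateX le_rfl (by norm_num) hφ ht₀
    (hS.exists_logTime_of_vacuum h hφ ht₀) (f := toY) (y := y)
  have hγ := hφ.hasDerivAt (S.coords (fun t => Real.exp (-3 * S.logTime t)) t₀)
  obtain ⟨τ, hτ⟩ := exists_χ_neg_of_vacuum hγ
  exact ⟨(hlim _).1 (tendsto_pointTflat le_rfl hs0 hs4 hγ hτ),
    (hlim _).2 (tendsto_pointD le_rfl hs0 hs4 hγ (Or.inl rfl))⟩

theorem IsMaximal.tendsto_of_linearFluid {w : ℝ} (hw : w ∈ Ioo (-1 / 3 : ℝ) 1)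
    {φ : ℝ → ℝ × ℝ × ℝ → ℝ × ℝ × ℝ} (hφ : IsGlobalFlow (field 1 (1 + 3 * w)) φ)
    (hS : IsMaximal (IsLinearFluid w) S I) (hH : ∀ t ∈ I, 0 < S.hubble t) {t₀ : ℝ} (ht₀ : t₀ ∈ I)
    (hG : S.stateX t₀ ∈ genericStates φ) :
    Tendsto (fun t : I => toY (S.stateX t)) atBot (𝓝 pointTflat) ∧
      (w < 0 → Tendsto (fun t : I => toY (S.stateX t)) atTop (𝓝 (pointP w))) ∧
      (0 ≤ w → Tendsto (fun t : I => toY (S.stateX t)) atTop (𝓝 pointD)) := by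
  have hs0 : 0 < 1 + 3 * w := by linarith [hw.1]
  have hs4 : 1 + 3 * w < 4 := by linarith [hw.2]
  have h := hS.1.isExpanding hH
  have hlim := fun y => h.tendsto_stateX zero_le_one hw hφ ht₀
    (hS.exists_logTime_of_linearFluid hw h hφ ht₀) (f := toY) (y := y)
  have hγ := hφ.hasDerivAt (S.coords S.ρ t₀)
  obtain ⟨-, hG⟩ := hG
  rw [h.stateX_eq zero_le_one ht₀, mem_preimage, ofState_toState, mem_iUnion₂] at hG
  obtain ⟨τ, -, hτ⟩ := hG
  refine ⟨(hlim _).1 (tendsto_pointTflat zero_le_one hs0 hs4 hγ hτ), fun hw0 => (hlim _).2 ?_,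
    fun hw0 => (hlim _).2 (tendsto_pointD zero_le_one hs0 hs4 hγ (Or.inr (by linarith)))⟩
  have e : 2 - (1 + 3 * w) = 1 - 3 * w := by ring
  have := tendsto_pointP one_pos hs0 (by linarith) hγ
  rwa [e] at this

end LRSModel

theorem mainTheorem2 :
    (∀ (S : LRSModel) (I : Set ℝ), LRSModel.IsMaximal LRSModel.IsVacuum S I →
      (∀ t ∈ I, 0 < S.hubble t) →
        Tendsto (fun t : I => toY (S.stateX t)) atBot (𝓝 pointTflat) ∧
        Tendsto (fun t : I => toY (S.stateX t)) atTop (𝓝 pointD)) ∧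
    (∀ w : ℝ, w ∈ Ioo (-1 / 3 : ℝ) 1 →
      ∃ G : Set (ℝ × ℝ × ℝ), G ⊆ XVIII ∧ IsOpen G ∧ volume (XVIII \ G) = 0 ∧
        ∀ (S : LRSModel) (I : Set ℝ), LRSModel.IsMaximal (LRSModel.IsLinearFluid w) S I →
          (∀ t ∈ I, 0 < S.hubble t) → (∃ t ∈ I, S.stateX t ∈ G) →
            Tendsto (fun t : I => toY (S.stateX t)) atBot (𝓝 pointTflat) ∧
            (w < 0 → Tendsto (fun t : I => toY (S.stateX t)) atTop (𝓝 (pointP w))) ∧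
            (0 ≤ w → Tendsto (fun t : I => toY (S.stateX t)) atTop (𝓝 pointD))) := by
  refine ⟨fun S I hS hH => hS.tendsto_of_vacuum hH, fun w hw => ?_⟩
  have hs0 : 0 < 1 + 3 * w := by linarith [hw.1]
  have hs4 : 1 + 3 * w < 4 := by linarith [hw.2]
  obtain ⟨φ, hφ⟩ := Reduced.exists_flow zero_le_one hs0 hs4
  exact ⟨Reduced.genericStates φ, inter_subset_left, Reduced.isOpen_genericStates hs0 hs4 hφ,
    Reduced.volume_diff_genericStates hs0 hs4 hφ, fun S I hS hH ⟨_, ht₀, hG⟩ =>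
      hS.tendsto_of_linearFluid hw hφ hH ht₀ hG⟩
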